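/- Let $M$ be a metric space with distance $\mathrm{dist}$, let $\mathrm{Ball}(x,r)=\{y\in M:\mathrm{dist}(x,y)\le r\}$ denote closed balls, let $\mathcal H^1$ be the one-dimensional Hausdorff (outer) measure on $M$, and for $\Gamma\subset M$ let $\mathcal H^1|_\Gamma$ be the Borel measure $E\mapsto\mathcal H^1(E\cap\Gamma)$. A set $\Gamma\subset M$ is called 1-Ahlfors-regular with constant $C_0>0$ if $$\frac{r}{C_0}\le \mathcal H^1|_\Gamma(\mathrm{Ball}(x,r))< C_0\,r\qquad\text{for all }x\in\Gamma\text{ and all real } r \text{ with } 0<r\le\mathrm{diam}(\Gamma),$$ where $\mathrm{diam}(\Gamma)\in[0,\infty]$. For $\epsilon>0$, an $\epsilon$-net for a set $K$ is a subset $X\subset K$ such that $\mathrm{dist}(x_1,x_2)>\epsilon$ for all distinct $x_1,x_2\in X$, and such that every $y\in K$ satisfies $\mathrm{dist}(x,y)\le\epsilon$ for some $x\in X$. For $x,y,z\in M$ put $\partial_1(x,y,z)=\mathrm{dist}(x,y)+\mathrm{dist}(y,z)-\mathrm{dist}(x,z)$, and let $\partial(\{x,y,z\})$ be the minimum of $\partial_1$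 over all orderings of $x,y,z$. **Theorem.** For every $C_0>0$ and $A>1$ there is a constant $C>0$, depending only on $C_0$ and $A$, such that the following holds. Let $M$ be any metric space, let $\Gamma\subset M$ be a connected set that is 1-Ahlfors-regular with constant $C_0$, let $K\subset\Gamma$, for each integer $n\in\mathbb Z$ let $X_n$ be a $2^{-n}$-net for $K$, and let $\hat{\mathcal G}^K$ be the multiresolution family of all balls $B=\mathrm{Ball}(x,A2^{-n})$ with $n\in\mathbb Z$ and $x\in X_n$ (indexed by the pairs $(n,x)$, with $\mathrm{radius}(B)=A2^{-n}$). Then $$\sum_{B\in\hat{\mathcal G}^K}\int_B\int_B\int_B \partial(\{x,y,z\})\,\mathrm{radius}(B)^{-3}\,d\mathcal H^1|_\Gamma(z)\,d\mathcal H^1|_\Gamma(y)\,d\mathcal H^1|_\Gamma(x)\;\le\; C\,\mathcal H^1(\Gamma).$$ (Both sides are elements of $[0,\infty]$.) -/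

import Mathlib

open MeasureTheory

noncomputable section

/-- `X` is an `ε`-net for `K`: a subset of `K` whose distinct points have distance `> ε` and such
that every point of `K` has distance at most `ε` from some point of `X`. -/
structure IsMetricNet {M : Type*} [MetricSpace M] (ε : ℝ) (X K : Set M) : Prop where
  subset : X ⊆ K
  separated : ∀ x₁ ∈ X, ∀ x₂ ∈ X, x₁ ≠ x₂ → ε < dist x₁ x₂
  covers : ∀ y ∈ K, ∃ x ∈ X, dist x y ≤ ε

/-- `K` is 1-Ahlfors-regular with constant `C`: for all `x ∈ K` and all real `0 < r ≤ diam K`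
(the diameter may be infinite), `r / C ≤ ℋ¹|_K (Ball(x, r)) < C r`, with closed balls. -/
def IsOneAhlforsRegular {M : Type*} [MetricSpace M] [MeasurableSpace M] [BorelSpace M]
    (C : ℝ) (K : Set M) : Prop :=
  0 < C ∧ ∀ x ∈ K, ∀ r : ℝ, 0 < r → ENNReal.ofReal r ≤ Metric.ediam K →
    ENNReal.ofReal (r / C) ≤ (Measure.hausdorffMeasure 1).restrict K (Metric.closedBall x r) ∧
    (Measure.hausdorffMeasure 1).restrict K (Metric.closedBall x r) < ENNReal.ofReal (C * r)

/-- The excess in the triangle inequality for the ordered triple `(x, y, z)`. -/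
def orderedExcess {M : Type*} [MetricSpace M] (x y z : M) : ℝ :=
  dist x y + dist y z - dist x z

/-- The excess of the unordered triple `{x, y, z}`: the minimum of the ordered excess over all
orderings. Reversing a triple does not change its ordered excess, so only the choice of the middle
point matters and three of the six orderings suffice. -/
def tripleExcess {M : Type*} [MetricSpace M] (x y z : M) : ℝ :=
  min (orderedExcess x y z) (min (orderedExcess y z x) (orderedExcess z x y))

/-- The integral of `∂({x, y, z}) r⁻³` over all triples in the closed ball `B = Ball(c, r)`, each
variable being integrated against `ℋ¹|_Γ`. -/
def ballExcess {M : Type*} [MetricSpace M] [MeasurableSpace M] [BorelSpace M]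
    (Γ : Set M) (c : M) (r : ℝ) : ENNReal :=
  ∫⁻ x in Metric.closedBall c r, ∫⁻ y in Metric.closedBall c r, ∫⁻ z in Metric.closedBall c r,
    ENNReal.ofReal (tripleExcess x y z * r ^ (-3 : ℤ))
      ∂((Measure.hausdorffMeasure 1).restrict Γ)
      ∂((Measure.hausdorffMeasure 1).restrict Γ)
      ∂((Measure.hausdorffMeasure 1).restrict Γ)

end

/-! The problem is discretised. For finitely many scales, `Γ` is replaced by a finite `ε`-net with
`ε` no larger than any of them. Since `Γ` is connected, a closed walk with steps at most `2ε` runs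
through the net, and Ahlfors regularity makes the number of its visits to a ball of radius `R ≥ 2ε`
at most a constant times `R/ε`. Dividing distances by `2ε` turns the walk into an `IsRegularTour` on
`ZMod N`, where `N ε` is bounded by a multiple of `ℋ¹(Γ)`. The core is
`IsRegularTour.sum_minExcess_le`: the excesses of triples of diameter about `2 ^ m`, weighted by `8
^ (-m)` and summed over all scales, are at most a constant times `N`.

For triples in tour order this is a telescoping argument. With `L a` the sum of the distances `D i
(i + a)`, the total excess for steps `a`, `b` is `L a + L b - L (a + b)`; weights comparable to `(a
+ b)⁻³` cancel everything except `L 1 ≤ N` and a negative boundary term (`sum_tourExcess_div_le`).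

A ball may also meet the tour in several far apart strands. If the tour comes back much too close to
an earlier point after time about `2 ^ m`, regularity forces it to have gone far away in between, so
many ordered triples have large excess; hence the pairs (scale, point) with a return number at most
a constant times `N` (`sum_card_isReturn_le`). Between two return scales of a point `i`, distinct
scales at which `i` is far from the arc of some nearby `s` yield long disjoint pieces of the tour
near `i`, and regularity bounds their number (`card_scales_le`). So the gaps `arcGap C D m i / 2 ^
m` are summable over all scales and points.

Finally, the excess of any triple is bounded by the gaps of two of its points plus an average of the
excess over triples on a single arc (`minExcess_le_sum_tourArc`), and both contributions are already
controlled. -/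

/-! ### Regular tours and the excess of triples. -/

/-- A pseudometric on the cyclic group `ZMod N` for which consecutive points have distance at most
`1` and every ball of radius `R ≥ 1` has at most `C * R` points. -/
structure IsRegularTour {N : ℕ} [NeZero N] (C : ℕ) (D : ZMod N → ZMod N → ℝ) : Prop where
  self : ∀ i, D i i = 0
  symm : ∀ i j, D i j = D j i
  triangle : ∀ i j k, D i k ≤ D i j + D j k
  step : ∀ i, D i (i + 1) ≤ 1
  card_ball : ∀ i (R : ℝ), 1 ≤ R → ((Finset.univ.filter fun j => D i j ≤ R).card : ℝ) ≤ C * R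

/-- The excess of the triangle inequality for a real function `D` of two variables. -/
def excess {ι : Type*} (D : ι → ι → ℝ) (x y z : ι) : ℝ := D x y + D y z - D x z

/-- The least excess of a triple over the choices of its middle point. -/
def minExcess {ι : Type*} (D : ι → ι → ℝ) (x y z : ι) : ℝ :=
  min (excess D x y z) (min (excess D y z x) (excess D z x y))

theorem minExcess_le_left {ι : Type*} (D : ι → ι → ℝ) (x y z : ι) :
    minExcess D x y z ≤ excess D x y z := min_le_left _ _

theorem minExcess_le_right {ι : Type*} (D : ι → ι → ℝ) (x y z : ι) :
    minExcess D x y z ≤ excess D y z x :=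
  (min_le_right _ _).trans (min_le_left _ _)

theorem minExcess_le_first {ι : Type*} (D : ι → ι → ℝ) (x y z : ι) :
    minExcess D x y z ≤ excess D z x y :=
  (min_le_right _ _).trans (min_le_right _ _)

namespace IsRegularTour

variable {N : ℕ} [NeZero N] {C : ℕ} {D : ZMod N → ZMod N → ℝ}

theorem nonneg (h : IsRegularTour C D) (i j : ZMod N) : 0 ≤ D i j := by
  have := h.triangle i j i
  rw [h.self, h.symm j i] at this
  linarith

theorem one_le (h : IsRegularTour C D) : 1 ≤ C := by
  have h1 := h.card_ball 0 1 le_rfl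
  have h2 : 0 < (Finset.univ.filter fun j => D 0 j ≤ 1).card :=
    Finset.card_pos.2 ⟨0, by simp [h.self]⟩
  have h3 : (1 : ℝ) ≤ (Finset.univ.filter fun j => D 0 j ≤ 1).card := by exact_mod_cast h2
  have : (1 : ℝ) ≤ C := by linarith
  exact_mod_cast this

theorem le_natCast (h : IsRegularTour C D) (i : ZMod N) (a : ℕ) : D i (i + a) ≤ a := by
  induction a with
  | zero => simp [h.self]
  | succ a ih =>
    have h1 := h.triangle i (i + a) (i + a + 1)
    have h2 := h.step (i + a)
    push_cast
    rw [← add_assoc]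
    linarith

theorem le_natCast' (h : IsRegularTour C D) (i : ZMod N) (a : ℕ) : D i (i - a) ≤ a := by
  have := h.le_natCast (i - a) a
  rw [sub_add_cancel] at this
  rwa [h.symm]

theorem le_val (h : IsRegularTour C D) (i j : ZMod N) : D i j ≤ (j - i).val := by
  have := h.le_natCast i (j - i).val
  rwa [ZMod.natCast_zmod_val, add_sub_cancel] at this

theorem lt_card (h : IsRegularTour C D) (i j : ZMod N) : D i j < N :=
  (h.le_val i j).trans_lt (by exact_mod_cast ZMod.val_lt _)

theorem excess_nonneg (h : IsRegularTour C D) (x y z : ZMod N) : 0 ≤ excess D x y z := by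
  have := h.triangle x y z
  unfold excess
  linarith

theorem minExcess_nonneg (h : IsRegularTour C D) (x y z : ZMod N) : 0 ≤ minExcess D x y z :=
  le_min (h.excess_nonneg _ _ _) (le_min (h.excess_nonneg _ _ _) (h.excess_nonneg _ _ _))

theorem excess_rev (h : IsRegularTour C D) (x y z : ZMod N) : excess D x y z = excess D z y x := by
  unfold excess
  rw [h.symm x y, h.symm y z, h.symm x z]
  ring

theorem excess_le_add (h : IsRegularTour C D) (x y z x' y' z' : ZMod N) :
    excess D x y z ≤ excess D x' y' z' + 2 * (D x x' + D y y' + D z z') := by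
  have h1 := h.triangle x x' y
  have h2 := h.triangle x' y' y
  have h3 := h.triangle y y' z
  have h4 := h.triangle y' z' z
  have h5 := h.triangle x' x z'
  have h6 := h.triangle x z z'
  unfold excess
  rw [h.symm y' y] at h2
  rw [h.symm z' z] at h4
  rw [h.symm x' x] at h5
  linarith

theorem minExcess_le_add (h : IsRegularTour C D) (x y z x' y' z' : ZMod N) :
    minExcess D x y z ≤ minExcess D x' y' z' + 2 * (D x x' + D y y' + D z z') := by
  have h1 := h.excess_le_add x y z x' y' z'
  have h2 := h.excess_le_add y z x y' z' x'
  have h3 := h.excess_le_add z x y z' x' y'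
  rw [← sub_le_iff_le_add]
  refine le_min ?_ (le_min ?_ ?_)
  · have := minExcess_le_left D x y z; linarith
  · have := minExcess_le_right D x y z; linarith
  · have := minExcess_le_first D x y z; linarith

theorem minExcess_le_two_mul (h : IsRegularTour C D) (x y z : ZMod N) :
    minExcess D x y z ≤ 2 * D x y := by
  have h1 := minExcess_le_left D x y z
  have h2 := h.triangle y x z
  rw [h.symm y x] at h2
  unfold excess at h1
  linarith

theorem minExcess_swap (h : IsRegularTour C D) (x y z : ZMod N) :
    minExcess D x y z = minExcess D x z y := by
  unfold minExcess
  rw [h.excess_rev x z y, h.excess_rev z y x, h.excess_rev y x z]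
  exact min_left_comm _ _ _

end IsRegularTour

/-! ### Ordered triples: telescoping along the tour. -/

theorem ZMod.sum_add_right {N : ℕ} [NeZero N] (f : ZMod N → ℝ) (a : ZMod N) :
    ∑ i, f (i + a) = ∑ i, f i :=
  Equiv.sum_comp (Equiv.addRight a) f

/-- The sum over the tour of the excesses of the triples `i, i + a, i + a + b`. -/
noncomputable def tourExcess {N : ℕ} [NeZero N] (D : ZMod N → ZMod N → ℝ) (a b : ℕ) : ℝ :=
  ∑ i, excess D i (i + a) (i + a + b)

/-- The sum over the tour of the distances from `i` to `i + a`. -/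
noncomputable def tourLength {N : ℕ} [NeZero N] (D : ZMod N → ZMod N → ℝ) (a : ℕ) : ℝ :=
  ∑ i, D i (i + a)

theorem tourExcess_eq {N : ℕ} [NeZero N] (D : ZMod N → ZMod N → ℝ) (a b : ℕ) :
    tourExcess D a b = tourLength D a + tourLength D b - tourLength D (a + b) := by
  unfold tourExcess tourLength excess
  rw [Finset.sum_sub_distrib, Finset.sum_add_distrib,
    ZMod.sum_add_right (fun i => D i (i + b)) a]
  simp [add_assoc]

/-- Telescoping: summation by parts with weights for which all but the boundary terms cancel. -/
theorem sum_antidiagonal_weighted (φ : ℕ → ℝ) (H : ℕ) :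
    ∑ n ∈ Finset.range H, 2 / (((n : ℝ) + 1) * (n + 2) * (n + 3)) *
        ∑ p ∈ Finset.HasAntidiagonal.antidiagonal n, (φ (p.1 + 1) + φ (p.2 + 1) - φ (p.1 + 1 + (p.2 + 1))) =
      φ 1 - 2 / (((H : ℝ) + 1) * (H + 2)) * ∑ j ∈ Finset.range (H + 1), φ (j + 1) := by
  -- The infinite tail of the weights from `n` on is `1 / ((n + 1)(n + 2))`. By the formula below,
  -- the coefficient of `φ j` in the infinite sum is therefore `2 / (j (j + 1)) - 2 / (j (j + 1)) =
  -- 0` for `j ≥ 2`, and `1` for `j = 1`.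
  have key : ∀ n : ℕ, ∑ p ∈ Finset.HasAntidiagonal.antidiagonal n,
      (φ (p.1 + 1) + φ (p.2 + 1) - φ (p.1 + 1 + (p.2 + 1))) =
      2 * (∑ j ∈ Finset.range (n + 1), φ (j + 1)) - (n + 1) * φ (n + 2) := by
    intro n
    rw [Finset.sum_sub_distrib, Finset.sum_add_distrib]
    have e1 : ∑ p ∈ Finset.HasAntidiagonal.antidiagonal n, φ (p.1 + 1) = ∑ j ∈ Finset.range (n + 1), φ (j + 1) :=
      Finset.Nat.sum_antidiagonal_eq_sum_range_succ (fun i _ => φ (i + 1)) n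
    have e2 : ∑ p ∈ Finset.HasAntidiagonal.antidiagonal n, φ (p.2 + 1) = ∑ j ∈ Finset.range (n + 1), φ (j + 1) := by
      rw [← e1]
      exact Finset.Nat.sum_antidiagonal_swap (f := fun p => φ (p.1 + 1))
    have e3 : ∑ p ∈ Finset.HasAntidiagonal.antidiagonal n, φ (p.1 + 1 + (p.2 + 1)) = (n + 1) * φ (n + 2) := by
      rw [Finset.sum_congr rfl (g := fun _ => φ (n + 2))]
      · simp
      · intro p hp
        rw [Finset.HasAntidiagonal.mem_antidiagonal] at hp
        congr 1
        omega
    rw [e1, e2, e3]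
    ring
  induction H with
  | zero => simp
  | succ H ih =>
    rw [Finset.sum_range_succ, ih, key, Finset.sum_range_succ _ (H + 1)]
    push_cast
    rw [show H + 1 + 1 = H + 2 from rfl]
    field_simp
    ring

theorem sum_comp_le_of_injOn {α β : Type*} {s : Finset α} {t : Finset β} {f : β → ℝ}
    (g : α → β) (hf : ∀ b, 0 ≤ f b) (hm : ∀ a ∈ s, g a ∈ t) (hg : Set.InjOn g s) :
    ∑ a ∈ s, f (g a) ≤ ∑ b ∈ t, f b := by
  classical
  rw [← Finset.sum_image (f := f) hg]
  exact Finset.sum_le_sum_of_subset_of_nonneg (Finset.image_subset_iff.2 hm) fun b _ _ => hf b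

namespace IsRegularTour

variable {N : ℕ} [NeZero N] {C : ℕ} {D : ZMod N → ZMod N → ℝ}

theorem tourExcess_nonneg (h : IsRegularTour C D) (a b : ℕ) : 0 ≤ tourExcess D a b :=
  Finset.sum_nonneg fun _ _ => h.excess_nonneg _ _ _

/-- The weights of the telescoping identity dominate `(x + y + 3)⁻³`, the boundary term has a
favourable sign, and the surviving term is the length of the tour, at most `N` because steps are at
most `1`. -/
theorem sum_tourExcess_div_le (h : IsRegularTour C D) (K : ℕ) :
    ∑ x ∈ Finset.range K, ∑ y ∈ Finset.range K,
      tourExcess D (x + 1) (y + 1) / ((x : ℝ) + y + 3) ^ 3 ≤ (N : ℝ) := by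
  have h1 := sum_antidiagonal_weighted (tourLength D) (2 * K)
  simp_rw [← tourExcess_eq] at h1
  have h2 : tourLength D 1 ≤ N := by
    unfold tourLength
    calc ∑ i, D i (i + (1 : ℕ)) ≤ ∑ _i : ZMod N, (1 : ℝ) :=
          Finset.sum_le_sum fun i _ => by simpa using h.step i
      _ = N := by simp
  have h3 : 0 ≤ ∑ j ∈ Finset.range (2 * K + 1), tourLength D (j + 1) :=
    Finset.sum_nonneg fun j _ => Finset.sum_nonneg fun i _ => h.nonneg _ _
  have h4 : 0 ≤ 2 / ((((2 * K : ℕ) : ℝ) + 1) * ((2 * K : ℕ) + 2)) *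
      ∑ j ∈ Finset.range (2 * K + 1), tourLength D (j + 1) := by positivity
  refine le_trans ?_ ((h1.le.trans (sub_le_self _ h4)).trans h2)
  rw [← Finset.sum_product']
  simp_rw [Finset.mul_sum]
  rw [Finset.sum_sigma']
  have h5 := sum_comp_le_of_injOn (s := Finset.range K ×ˢ Finset.range K)
    (t := (Finset.range (2 * K)).sigma fun n => Finset.HasAntidiagonal.antidiagonal n)
    (f := fun q : Σ _ : ℕ, ℕ × ℕ => 2 / (((q.1 : ℝ) + 1) * (q.1 + 2) * (q.1 + 3)) *
      tourExcess D (q.2.1 + 1) (q.2.2 + 1)) (fun p => ⟨p.1 + p.2, p⟩)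
    (fun b => mul_nonneg (by positivity) (h.tourExcess_nonneg _ _))
    (fun p hp => by
      simp only [Finset.mem_product, Finset.mem_range] at hp
      simp only [Finset.mem_sigma, Finset.mem_range, Finset.HasAntidiagonal.mem_antidiagonal, and_true]
      omega)
    (fun p _ q _ hpq => by simp at hpq; exact hpq.2)
  refine le_trans (Finset.sum_le_sum fun p _ => ?_) h5
  have h6 := h.tourExcess_nonneg (p.1 + 1) (p.2 + 1)
  rw [div_eq_inv_mul]
  refine mul_le_mul_of_nonneg_right ?_ h6
  push_cast
  set z : ℝ := (p.1 : ℝ) + p.2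
  have hz : 0 ≤ z := by positivity
  rw [inv_eq_one_div, div_le_div_iff₀ (by positivity) (by positivity)]
  nlinarith [mul_nonneg hz hz, mul_nonneg hz (mul_nonneg hz hz)]

end IsRegularTour

/-! ### Packing estimate for returns. -/

/-- The point `i` sees a return of the tour at scale `2 ^ m`: two points of the tour whose distance
along the tour is about `2 ^ m` are much closer to each other in `D`, and one of them is near `i`. -/
def IsReturn {N : ℕ} (C : ℕ) (D : ZMod N → ZMod N → ℝ) (m : ℕ) (i : ZMod N) : Prop :=
  ∃ (s : ZMod N) (a : ℕ), 2 ^ m ≤ a ∧ a < 2 ^ (m + 1) ∧ a < N ∧ 4 * C * D s (s + a) ≤ a ∧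
    D i s ≤ 2 ^ m

/-- The pairs of steps whose total length is about `2 ^ m`. -/
def scalePairs (m : ℕ) : Finset (ℕ × ℕ) :=
  (Finset.range (2 ^ (m + 2)) ×ˢ Finset.range (2 ^ (m + 2))).filter fun p =>
    2 ^ m < p.1 + p.2 + 3 ∧ p.1 + p.2 + 3 ≤ 2 ^ (m + 2)

/-- The weighted excess of the triple starting at `s` with steps `p.1 + 1` and `p.2 + 1`. -/
noncomputable def weightedExcess {N : ℕ} (D : ZMod N → ZMod N → ℝ) (s : ZMod N) (p : ℕ × ℕ) : ℝ :=
  excess D s (s + (p.1 + 1 : ℕ)) (s + (p.1 + 1 : ℕ) + (p.2 + 1 : ℕ)) / ((p.1 : ℝ) + p.2 + 3) ^ 3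

theorem ZMod.natCast_injOn {N a : ℕ} (ha : a ≤ N) :
    Set.InjOn (fun b : ℕ => (b : ZMod N)) (Finset.range a) := by
  intro b hb b' hb' hbb
  simp only [Finset.coe_range, Set.mem_Iio] at hb hb'
  have := congrArg ZMod.val hbb
  rwa [ZMod.val_cast_of_lt (hb.trans_le ha), ZMod.val_cast_of_lt (hb'.trans_le ha)] at this

namespace IsRegularTour

variable {N : ℕ} [NeZero N] {C : ℕ} {D : ZMod N → ZMod N → ℝ}

theorem weightedExcess_nonneg (h : IsRegularTour C D) (s : ZMod N) (p : ℕ × ℕ) :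
    0 ≤ weightedExcess D s p :=
  div_nonneg (h.excess_nonneg _ _ _) (by positivity)

/-- Pigeonhole: a ball of radius `a / (2 * C)` has at most `a / 2` points, so it cannot contain `a`
distinct points of the tour. The bound `2 * C ≤ a` makes this radius at least `1`. -/
theorem exists_far_of_le (h : IsRegularTour C D) (s : ZMod N) {a : ℕ} (ha : a ≤ N)
    (hC : 2 * C ≤ a) : ∃ b < a, (a : ℝ) ≤ 2 * C * D s (s + b) := by
  by_contra! hc
  have hC1 : (1 : ℝ) ≤ C := by exact_mod_cast h.one_le
  have hCa : (2 * C : ℝ) ≤ a := by exact_mod_cast hC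
  have h1 := h.card_ball s (a / (2 * C)) (by rw [le_div_iff₀ (by positivity)]; linarith)
  have h2 : a ≤ (Finset.univ.filter fun j => D s j ≤ a / (2 * C)).card := by
    have := Finset.card_le_card_of_injOn (s := Finset.range a)
      (t := Finset.univ.filter fun j => D s j ≤ a / (2 * C)) (fun b : ℕ => s + (b : ZMod N))
      (fun b hb => by
        have hb' := hc b (Finset.mem_range.1 hb)
        simp only [Finset.coe_filter, Finset.mem_univ, true_and, Set.mem_ofPred_eq]
        rw [le_div_iff₀ (by positivity)]
        linarith)
      (fun b hb b' hb' hbb => ZMod.natCast_injOn ha hb hb' (add_left_cancel hbb))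
    simpa using this
  have h3 : (a : ℝ) ≤ C * (a / (2 * C)) := le_trans (by exact_mod_cast h2) h1
  have h4 : (C : ℝ) * (a / (2 * C)) = a / 2 := by field_simp
  linarith

/-- Between the two close points `s` and `s + a` the tour visits a far point `s + b`, so the triple
has excess at least `a / (2 * C)`. Moving each of the three points independently by up to `a / (32 *
C)` steps preserves half of it, which gives about `(2 ^ m / C) ^ 3` triples of weighted excess at
least a multiple of `4 ^ (-m) / C`. -/
theorem pow_le_sum_weightedExcess (h : IsRegularTour C D) {m : ℕ} {i : ZMod N}
    (hm : 2 * C ≤ 2 ^ m) (hr : IsReturn C D m i) :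
    (2 : ℝ) ^ m ≤ 2 ^ 23 * C ^ 4 * ∑ s ∈ Finset.univ.filter (fun s => D i s ≤ 4 * 2 ^ m),
      ∑ p ∈ scalePairs m, weightedExcess D s p := by
  obtain ⟨s, a, ha1, ha2, haN, hsa, his⟩ := hr
  obtain ⟨b, hba, hb⟩ := h.exists_far_of_le s haN.le (hm.trans ha1)
  have hC1 : (1 : ℝ) ≤ C := by exact_mod_cast h.one_le
  have hC0 := h.one_le
  obtain ⟨q, hq⟩ : ∃ q, q = a / (32 * C) := ⟨_, rfl⟩
  have hq1 : q * (32 * C) ≤ a := hq ▸ Nat.div_mul_le_self _ _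
  have hq2 : a < (q + 1) * (32 * C) := by
    rw [hq]
    have := Nat.lt_div_mul_add (a := a) (b := 32 * C) (by omega)
    linarith
  have hq3 : q * 32 ≤ a := le_trans (Nat.mul_le_mul_left _ (by omega)) hq1
  have hpow : 2 ^ (m + 1) = 2 * 2 ^ m := by ring
  have hpow2 : 2 ^ (m + 2) = 4 * 2 ^ m := by ring
  have hm1 : 1 ≤ 2 ^ m := Nat.one_le_two_pow
  have hq1' : (q : ℝ) * (32 * C) ≤ a := by exact_mod_cast hq1
  have hq2' : (a : ℝ) < (q + 1) * (32 * C) := by exact_mod_cast hq2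
  have ha1' : (2 : ℝ) ^ m ≤ a := by exact_mod_cast ha1
  have ha2' : (a : ℝ) ≤ 2 * 2 ^ m := by
    have : a ≤ 2 * 2 ^ m := by omega
    exact_mod_cast this
  have hpos : (0 : ℝ) < 2 ^ m := by positivity
  have hex : (a : ℝ) ≤ 2 * C * excess D s (s + b) (s + a) := by
    have := h.triangle s (s + a) (s + b)
    rw [h.symm (s + a)] at this
    unfold excess
    nlinarith
  -- The middle point, shifted forward by up to `q`, must stay before the end point: `s + b` is at
  -- distance at least `a / (4 * C)` from `s + a`, hence that many steps before it.
  have hbq : b + q < a := by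
    have h1 := h.triangle s (s + a) (s + b)
    have h2 := h.le_natCast (s + b) (a - b)
    rw [Nat.cast_sub hba.le, add_assoc, add_sub_cancel, h.symm (s + b), Nat.cast_sub hba.le] at h2
    have h3 : (a : ℝ) ≤ 4 * C * (a - b) := by nlinarith
    have h4 : (b : ℝ) + q < a := by nlinarith
    exact_mod_cast h4
  have hb0 : 1 ≤ b := by
    rcases Nat.eq_zero_or_pos b with rfl | hb0
    · simp [h.self] at hb
      have : (0 : ℝ) < a := hpos.trans_le ha1'
      linarith
    · exact hb0
  have key := sum_comp_le_of_injOn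
    (s := Finset.range (q + 1) ×ˢ (Finset.range (q + 1) ×ˢ Finset.range (q + 1)))
    (t := Finset.univ.filter (fun s => D i s ≤ 4 * 2 ^ m) ×ˢ scalePairs m)
    (f := fun sp => weightedExcess D sp.1 sp.2)
    -- The start moves back while the middle and the end move forward; pairs in `scalePairs` store
    -- step lengths minus one.
    (fun r => (s - (r.1 : ℕ), (r.1 + b + r.2.1 - 1, a + r.2.2 - b - r.2.1 - 1)))
    (fun _ => h.weightedExcess_nonneg _ _)
    (fun r hr => by
      simp only [Finset.mem_product, Finset.mem_range] at hr
      simp only [Finset.mem_product, Finset.mem_filter, Finset.mem_univ, true_and, scalePairs,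
        Finset.mem_range]
      refine ⟨?_, by omega⟩
      have h1 := h.triangle i s (s - (r.1 : ℕ))
      have h2 := h.le_natCast' s r.1
      have h3 : (r.1 : ℝ) ≤ a := by
        have : r.1 ≤ a := by omega
        exact_mod_cast this
      linarith)
    (fun r hr r' hr' hrr => by
      simp only [Finset.coe_product, Set.mem_prod, Finset.coe_range, Set.mem_Iio] at hr hr'
      simp only [Prod.mk.injEq] at hrr
      have h1 := ZMod.natCast_injOn (N := N) (a := q + 1) (by omega)
        (by simpa using hr.1) (by simpa using hr'.1) (sub_right_injective hrr.1)
      ext <;> omega)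
  rw [Finset.sum_product (Finset.univ.filter _) (scalePairs m)] at key
  have hterm : ∀ r ∈ Finset.range (q + 1) ×ˢ (Finset.range (q + 1) ×ˢ Finset.range (q + 1)),
      1 / (256 * C * (2 ^ m) ^ 2) ≤ weightedExcess D (s - (r.1 : ℕ))
        (r.1 + b + r.2.1 - 1, a + r.2.2 - b - r.2.1 - 1) := by
    intro r hr
    simp only [Finset.mem_product, Finset.mem_range] at hr
    unfold weightedExcess
    have e1 : s - (r.1 : ZMod N) + ((r.1 + b + r.2.1 - 1 + 1 : ℕ) : ZMod N) = s + b + r.2.1 := by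
      rw [Nat.sub_add_cancel (by omega)]
      push_cast
      ring
    have e2 : s + b + (r.2.1 : ZMod N) + ((a + r.2.2 - b - r.2.1 - 1 + 1 : ℕ) : ZMod N) =
        s + a + r.2.2 := by
      rw [Nat.sub_add_cancel (by omega), Nat.cast_sub (by omega), Nat.cast_sub (by omega)]
      push_cast
      ring
    have e3 : ((r.1 + b + r.2.1 - 1 : ℕ) : ℝ) + (a + r.2.2 - b - r.2.1 - 1 : ℕ) + 3 =
        r.1 + a + r.2.2 + 1 := by
      have : r.1 + b + r.2.1 - 1 + (a + r.2.2 - b - r.2.1 - 1) + 3 = r.1 + a + r.2.2 + 1 := by omega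
      exact_mod_cast this
    simp only [e1, e2, e3]
    have h1 := h.excess_le_add s (s + b) (s + a) (s - (r.1 : ℕ)) (s + b + (r.2.1 : ℕ))
      (s + a + (r.2.2 : ℕ))
    have h2 := h.le_natCast' s r.1
    have h3 := h.le_natCast (s + b) r.2.1
    have h4 := h.le_natCast (s + a) r.2.2
    have h5 : (r.1 : ℝ) + r.2.1 + r.2.2 ≤ 3 * q := by
      have : r.1 + r.2.1 + r.2.2 ≤ 3 * q := by omega
      exact_mod_cast this
    have h6 : (r.1 : ℝ) + a + r.2.2 + 1 ≤ 4 * 2 ^ m := by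
      have : r.1 + a + r.2.2 + 1 ≤ 4 * 2 ^ m := by omega
      exact_mod_cast this
    have h7 : (2 : ℝ) ^ m ≤ 4 * C * excess D (s - (r.1 : ℕ)) (s + b + (r.2.1 : ℕ))
      (s + a + (r.2.2 : ℕ)) := by nlinarith
    rw [div_le_div_iff₀ (by positivity) (by positivity)]
    have h8 : ((r.1 : ℝ) + a + r.2.2 + 1) ^ 3 ≤ (4 * 2 ^ m) ^ 3 := by gcongr
    calc 1 * ((r.1 : ℝ) + a + r.2.2 + 1) ^ 3 ≤ 64 * (2 ^ m) ^ 2 * 2 ^ m := by linarith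
      _ ≤ 64 * (2 ^ m) ^ 2 * (4 * C * excess D (s - (r.1 : ℕ)) (s + b + (r.2.1 : ℕ))
          (s + a + (r.2.2 : ℕ))) := by gcongr
      _ = _ := by ring
  have h9 := (Finset.card_nsmul_le_sum _ _ _ hterm).trans key
  simp only [Finset.card_product, Finset.card_range, nsmul_eq_mul] at h9
  refine le_trans ?_ (mul_le_mul_of_nonneg_left h9 (by positivity))
  have h10 : (2 : ℝ) ^ m ≤ (q + 1) * (32 * C) := ha1'.trans hq2'.le
  have h11 : ((2 : ℝ) ^ m) ^ 3 ≤ ((q + 1) * (32 * C)) ^ 3 := by gcongr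
  push_cast
  rw [mul_one_div, mul_div_assoc', le_div_iff₀ (by positivity)]
  calc (2 : ℝ) ^ m * (256 * (C : ℝ) * ((2 : ℝ) ^ m) ^ 2) = 256 * (C : ℝ) * ((2 : ℝ) ^ m) ^ 3 := by
        ring
    _ ≤ 256 * (C : ℝ) * (((q : ℝ) + 1) * (32 * (C : ℝ))) ^ 3 := by gcongr
    _ = 2 ^ 23 * (C : ℝ) ^ 4 * (((q : ℝ) + 1) * (((q : ℝ) + 1) * ((q : ℝ) + 1))) := by ring

-- Double counting: each return point collects at least a multiple of `2 ^ m` of weighted excess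
-- from the starting points in a ball of radius `4 * 2 ^ m`, while each starting point serves at
-- most `4 * C * 2 ^ m` return points. The powers of `2 ^ m` cancel.
open Classical in
theorem card_isReturn_le (h : IsRegularTour C D) {m : ℕ} (hm : 2 * C ≤ 2 ^ m) :
    ((Finset.univ.filter fun i => IsReturn C D m i).card : ℝ) ≤
      2 ^ 25 * C ^ 5 * ∑ s, ∑ p ∈ scalePairs m, weightedExcess D s p := by
  have hpos : (0 : ℝ) < 2 ^ m := by positivity
  have hE : ∀ s, 0 ≤ ∑ p ∈ scalePairs m, weightedExcess D s p := fun s =>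
    Finset.sum_nonneg fun p _ => h.weightedExcess_nonneg s p
  have h1 : ((Finset.univ.filter fun i => IsReturn C D m i).card : ℝ) * 2 ^ m ≤
      ∑ i, 2 ^ 23 * C ^ 4 * ∑ s ∈ Finset.univ.filter (fun s => D i s ≤ 4 * 2 ^ m),
      ∑ p ∈ scalePairs m, weightedExcess D s p := by
    rw [← nsmul_eq_mul, ← Finset.sum_const, Finset.sum_filter]
    refine Finset.sum_le_sum fun i _ => ?_
    split_ifs with hi
    · exact h.pow_le_sum_weightedExcess hm hi
    · exact mul_nonneg (by positivity) (Finset.sum_nonneg fun s _ => hE s)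
  have h2 : ∑ i, ∑ s ∈ Finset.univ.filter (fun s => D i s ≤ 4 * 2 ^ m),
      ∑ p ∈ scalePairs m, weightedExcess D s p ≤
      (C * (4 * 2 ^ m)) * ∑ s, ∑ p ∈ scalePairs m, weightedExcess D s p := by
    simp_rw [Finset.sum_filter]
    rw [Finset.sum_comm, Finset.mul_sum]
    refine Finset.sum_le_sum fun s _ => ?_
    rw [← Finset.sum_filter, Finset.sum_const, nsmul_eq_mul]
    refine mul_le_mul_of_nonneg_right ?_ (hE s)
    simp_rw [h.symm _ s]
    exact h.card_ball s _ (by have : (1 : ℝ) ≤ 2 ^ m := one_le_pow₀ (by norm_num)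
                              linarith)
  rw [← Finset.mul_sum] at h1
  have h3 := h1.trans (mul_le_mul_of_nonneg_left h2 (by positivity))
  refine le_of_mul_le_mul_right (h3.trans (le_of_eq ?_)) hpos
  ring

theorem sum_scalePairs_le (h : IsRegularTour C D) (M : ℕ) :
    ∑ m ∈ Finset.range M, ∑ s, ∑ p ∈ scalePairs m, weightedExcess D s p ≤ 2 * N := by
  have hK : ∀ m ∈ Finset.range M, 2 ^ (m + 2) ≤ 2 ^ (M + 2) := fun m hm =>
    Nat.pow_le_pow_right (by norm_num) (by have := Finset.mem_range.1 hm; omega)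
  set P := Finset.range (2 ^ (M + 2)) ×ˢ Finset.range (2 ^ (M + 2)) with hP
  have h1 : ∀ m ∈ Finset.range M, ∑ s, ∑ p ∈ scalePairs m, weightedExcess D s p =
      ∑ p ∈ P, if 2 ^ m < p.1 + p.2 + 3 ∧ p.1 + p.2 + 3 ≤ 2 ^ (m + 2) then
        ∑ s, weightedExcess D s p else 0 := by
    intro m hm
    rw [Finset.sum_comm, ← Finset.sum_filter]
    refine Finset.sum_congr ?_ fun _ _ => rfl
    ext p
    have := hK m hm
    simp only [scalePairs, hP, Finset.mem_filter, Finset.mem_product, Finset.mem_range]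
    omega
  rw [Finset.sum_congr rfl h1, Finset.sum_comm]
  have h2 := h.sum_tourExcess_div_le (2 ^ (M + 2))
  rw [← Finset.sum_product', ← hP] at h2
  refine le_trans ?_ (mul_le_mul_of_nonneg_left h2 (by norm_num : (0 : ℝ) ≤ 2))
  rw [Finset.mul_sum]
  refine Finset.sum_le_sum fun p _ => ?_
  rw [← Finset.sum_filter, Finset.sum_const, nsmul_eq_mul]
  have h3 : ∑ s, weightedExcess D s p = tourExcess D (p.1 + 1) (p.2 + 1) / ((p.1 : ℝ) + p.2 + 3) ^ 3 := by
    unfold weightedExcess tourExcess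
    rw [Finset.sum_div]
  rw [h3]
  refine mul_le_mul_of_nonneg_right ?_ (div_nonneg (h.tourExcess_nonneg _ _) (by positivity))
  -- With `l` the rounded-up binary logarithm of the total length, a pair can belong only to the
  -- scales `l - 2` and `l - 1`; this is the factor `2`.
  obtain ⟨l, hl1, hl2⟩ : ∃ l, p.1 + p.2 + 3 ≤ 2 ^ l ∧ ∀ m, p.1 + p.2 + 3 ≤ 2 ^ m → l ≤ m :=
    ⟨Nat.clog 2 (p.1 + p.2 + 3), Nat.le_pow_clog (by norm_num) _,
      fun m hm => (Nat.clog_le_iff_le_pow (by norm_num)).2 hm⟩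
  have h4 : (Finset.range M).filter
      (fun m => 2 ^ m < p.1 + p.2 + 3 ∧ p.1 + p.2 + 3 ≤ 2 ^ (m + 2)) ⊆ Finset.Ico (l - 2) l := by
    intro m hm
    simp only [Finset.mem_filter] at hm
    have h5 := hl2 _ hm.2.2
    have h6 : m < l := (Nat.pow_lt_pow_iff_right (by norm_num : 1 < 2)).1 (hm.2.1.trans_le hl1)
    simp only [Finset.mem_Ico]
    omega
  have h7 := Finset.card_le_card h4
  rw [Nat.card_Ico] at h7
  have h8 : ((Finset.range M).filter
      (fun m => 2 ^ m < p.1 + p.2 + 3 ∧ p.1 + p.2 + 3 ≤ 2 ^ (m + 2))).card ≤ 2 := by omega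
  exact_mod_cast h8

-- The Carleson packing condition for returns. Scales `m < 2 * C` are too small for the pigeonhole
-- argument and are counted trivially; for the others `2 * C ≤ m < 2 ^ m`.
open Classical in
theorem sum_card_isReturn_le (h : IsRegularTour C D) (M : ℕ) :
    ∑ m ∈ Finset.range M, ((Finset.univ.filter fun i => IsReturn C D m i).card : ℝ) ≤
      2 ^ 27 * C ^ 5 * N := by
  have hC1 : (1 : ℝ) ≤ C := by exact_mod_cast h.one_le
  have h1 : ∀ m ∈ Finset.range M, ((Finset.univ.filter fun i => IsReturn C D m i).card : ℝ) ≤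
      (if m < 2 * C then (N : ℝ) else 0) +
      2 ^ 25 * C ^ 5 * ∑ s, ∑ p ∈ scalePairs m, weightedExcess D s p := by
    intro m _
    have hE : 0 ≤ ∑ s, ∑ p ∈ scalePairs m, weightedExcess D s p :=
      Finset.sum_nonneg fun s _ => Finset.sum_nonneg fun p _ => h.weightedExcess_nonneg s p
    split_ifs with hm
    · refine le_add_of_le_of_nonneg ?_ (by positivity)
      have := Finset.card_le_univ (Finset.univ.filter fun i => IsReturn C D m i)
      rw [ZMod.card] at this
      exact_mod_cast this
    · rw [zero_add]
      exact h.card_isReturn_le ((not_lt.1 hm).trans Nat.lt_two_pow_self.le)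
  refine (Finset.sum_le_sum h1).trans ?_
  rw [Finset.sum_add_distrib, ← Finset.mul_sum, ← Finset.sum_filter, Finset.sum_const,
    nsmul_eq_mul]
  have h2 : (((Finset.range M).filter fun m => m < 2 * C).card : ℝ) ≤ 2 * C := by
    have : ((Finset.range M).filter fun m => m < 2 * C) ⊆ Finset.range (2 * C) := fun m hm => by
      simpa using (Finset.mem_filter.1 hm).2
    have := Finset.card_le_card this
    rw [Finset.card_range] at this
    exact_mod_cast this
  have h3 := h.sum_scalePairs_le M
  have h4 : (C : ℝ) ≤ C ^ 5 := le_self_pow₀ hC1 (by norm_num)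
  have hN : (0 : ℝ) ≤ N := by positivity
  calc _ ≤ 2 * (C ^ 5 : ℝ) * N + 2 ^ 25 * C ^ 5 * (2 * N) := by gcongr; linarith
    _ ≤ _ := by
      have : 0 ≤ (C ^ 5 : ℝ) * N := by positivity
      nlinarith

end IsRegularTour

/-! ### Gaps between points and nearby arcs. -/

/-- The points of the tour at distance at most `K` from `s` along the tour. -/
def tourArc {N : ℕ} [NeZero N] (s : ZMod N) (K : ℕ) : Finset (ZMod N) :=
  Finset.univ.filter fun t => (t - s).val ≤ K ∨ (s - t).val ≤ K

theorem self_mem_tourArc {N : ℕ} [NeZero N] (s : ZMod N) (K : ℕ) : s ∈ tourArc s K := by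
  simp [tourArc]

/-- The distance of `i` to the arc of length `K` on both sides of `s`. -/
noncomputable def arcDist {N : ℕ} [NeZero N] (D : ZMod N → ZMod N → ℝ) (s : ZMod N) (K : ℕ)
    (i : ZMod N) : ℝ :=
  (tourArc s K).inf' ⟨s, self_mem_tourArc s K⟩ fun t => D t i

/-- The largest distance of `i` to the arcs at scale `2 ^ m` around the points `2 ^ m`-close
to `i`. -/
noncomputable def arcGap {N : ℕ} [NeZero N] (C : ℕ) (D : ZMod N → ZMod N → ℝ) (m : ℕ)
    (i : ZMod N) : ℝ :=
  Finset.univ.sup' Finset.univ_nonempty fun s : ZMod N =>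
    if D s i ≤ 2 ^ m then arcDist D s (8 * C * 2 ^ m) i else 0

/-- A dyadic layer-cake decomposition, which reduces a sum of gaps to counting the scales at which
the gap exceeds a given threshold. -/
theorem le_sum_dyadic (x : ℝ) (hx : x ≤ 1) (J : ℕ) :
    x ≤ (1 / 2) ^ J + ∑ k ∈ Finset.range J, (1 / 2 : ℝ) ^ k *
      (if (1 / 2 : ℝ) ^ (k + 1) < x then 1 else 0) := by
  induction J with
  | zero => simpa using hx
  | succ J ih =>
    rw [Finset.sum_range_succ]
    split_ifs with hJ
    · have : (0 : ℝ) < (1 / 2) ^ (J + 1) := by positivity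
      linarith
    · have : 0 ≤ ∑ k ∈ Finset.range J, (1 / 2 : ℝ) ^ k *
          (if (1 / 2 : ℝ) ^ (k + 1) < x then 1 else 0) :=
        Finset.sum_nonneg fun k _ => by positivity
      linarith

theorem sum_succ_mul_pow_half_le (J : ℕ) :
    ∑ k ∈ Finset.range J, (1 / 2 : ℝ) ^ k * (k + 1) ≤ 4 := by
  have : ∀ J : ℕ, ∑ k ∈ Finset.range J, (1 / 2 : ℝ) ^ k * (k + 1) =
      4 - (2 * J + 4) * (1 / 2) ^ J := by
    intro J
    induction J with
    | zero => norm_num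
    | succ J ih =>
      rw [Finset.sum_range_succ, ih]
      push_cast
      ring
  rw [this]
  have : (0 : ℝ) ≤ (2 * J + 4) * (1 / 2) ^ J := by positivity
  linarith

namespace IsRegularTour

variable {N : ℕ} [NeZero N] {C : ℕ} {D : ZMod N → ZMod N → ℝ}

theorem arcDist_nonneg (h : IsRegularTour C D) (s : ZMod N) (K : ℕ) (i : ZMod N) :
    0 ≤ arcDist D s K i :=
  Finset.le_inf' _ _ fun t _ => h.nonneg t i

theorem arcDist_le (s : ZMod N) (K : ℕ) (i : ZMod N) : arcDist D s K i ≤ D s i :=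
  Finset.inf'_le _ (self_mem_tourArc s K)

theorem arcDist_le_arcGap {s i : ZMod N} {m : ℕ} (hs : D s i ≤ 2 ^ m) :
    arcDist D s (8 * C * 2 ^ m) i ≤ arcGap C D m i := by
  have := Finset.le_sup' (fun s : ZMod N =>
    if D s i ≤ 2 ^ m then arcDist D s (8 * C * 2 ^ m) i else 0) (Finset.mem_univ s)
  rwa [if_pos hs] at this

theorem arcGap_nonneg (h : IsRegularTour C D) (m : ℕ) (i : ZMod N) : 0 ≤ arcGap C D m i :=
  (h.arcDist_nonneg i _ i).trans (arcDist_le_arcGap (by rw [h.self]; positivity))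

theorem arcGap_le (m : ℕ) (i : ZMod N) : arcGap C D m i ≤ 2 ^ m := by
  refine Finset.sup'_le _ _ fun s _ => ?_
  split_ifs with hs
  · exact (arcDist_le s _ i).trans hs
  · positivity

theorem exists_of_lt_arcGap {m : ℕ} {i : ZMod N} {δ : ℝ} (hδ : 0 ≤ δ) (h : δ < arcGap C D m i) :
    ∃ s, D s i ≤ 2 ^ m ∧ ∀ t ∈ tourArc s (8 * C * 2 ^ m), δ < D t i := by
  obtain ⟨s, -, hs⟩ := (Finset.lt_sup'_iff _).1 h
  split_ifs at hs with hsi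
  · exact ⟨s, hsi, fun t ht => (Finset.lt_inf'_iff _).1 hs t ht⟩
  · exact absurd hs (not_lt.2 hδ)

/-- Each scale `m` provides a point `s m` near `i` whose arc avoids a neighbourhood of `i`. The
spacing of the scales puts the points of smaller scales inside that neighbourhood, so the points are
far apart along the tour though close in `D`; without returns this forces tour distances of at least
twice the largest scale `2 ^ T`. Then the pieces of `2 ^ T` points starting at the `s m` are
disjoint and lie in the ball of radius `2 * 2 ^ T` around `i`, which has room for at most `2 * C` of
them. -/
theorem card_scales_le (h : IsRegularTour C D) (i : ZMod N) (k : ℕ) (S : Finset ℕ)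
    (hgap : ∀ m ∈ S, (1 / 2) ^ (k + 1) * 2 ^ m < arcGap C D m i)
    (hmod : ∀ m ∈ S, ∀ m' ∈ S, m' < m → m' + (k + 1) ≤ m)
    (hret : ∀ m ∈ S, ∀ m' ∈ S, ∀ μ, m < μ → μ ≤ m' → ¬ IsReturn C D μ i) :
    S.card ≤ 2 * C := by
  have hC0 := h.one_le
  have hC1 : (1 : ℝ) ≤ C := by exact_mod_cast hC0
  by_contra! hcard
  have hne : S.Nonempty := Finset.card_pos.1 (by omega)
  obtain ⟨T, hT, hmax⟩ : ∃ T ∈ S, ∀ m ∈ S, m ≤ T := ⟨S.max' hne, S.max'_mem hne, S.le_max'⟩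
  choose! s hs1 hs2 using fun m hm => exists_of_lt_arcGap (by positivity) (hgap m hm)
  have hfar : ∀ m ∈ S, ∀ m' ∈ S, m' < m →
      8 * C * 2 ^ m < (s m' - s m).val ∧ 8 * C * 2 ^ m < (s m - s m').val := by
    intro m hm m' hm' hlt
    have h1 : s m' ∉ tourArc (s m) (8 * C * 2 ^ m) := by
      intro hmem
      have h2 := hs2 m hm _ hmem
      have h3 : (2 : ℝ) ^ (m' + (k + 1)) ≤ 2 ^ m :=
        pow_le_pow_right₀ (by norm_num) (hmod m hm m' hm' hlt)
      have h4 : (2 : ℝ) ^ m' ≤ (1 / 2) ^ (k + 1) * 2 ^ m := by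
        rw [one_div, inv_pow, inv_mul_eq_div, le_div_iff₀ (by positivity), ← pow_add]
        exact h3
      linarith [hs1 m' hm']
    simpa [tourArc] using h1
  -- Points with `D x y ≤ 2 * 2 ^ m` and tour distance above `8 * C * 2 ^ m` form a return at the
  -- binary logarithm `μ` of that distance. As `μ > m` and no return is allowed up to `T`, it
  -- follows that `μ > T`.
  have hlong : ∀ m ∈ S, ∀ x y : ZMod N, D x i ≤ 2 ^ m → D y i ≤ 2 ^ m →
      8 * C * 2 ^ m < (y - x).val → 2 ^ (T + 1) ≤ (y - x).val := by
    intro m hm x y hx hy hxy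
    have hm1 : 1 ≤ 2 ^ m := Nat.one_le_two_pow
    have hCm : 2 ^ m ≤ C * 2 ^ m := Nat.le_mul_of_pos_left _ hC0
    have hlog1 := Nat.pow_log_le_self 2 (x := (y - x).val) (by nlinarith)
    have hlog2 := Nat.lt_pow_succ_log_self (b := 2) (by norm_num) (y - x).val
    obtain ⟨μ, hμ⟩ : ∃ μ, μ = Nat.log 2 (y - x).val := ⟨_, rfl⟩
    rw [← hμ] at hlog1 hlog2
    rw [Nat.succ_eq_add_one] at hlog2
    have h2 : 2 ^ (μ + 1) = 2 * 2 ^ μ := by ring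
    have h3 : 2 ^ m < 2 ^ μ := by nlinarith
    have h4 : m < μ := (Nat.pow_lt_pow_iff_right (by norm_num : 1 < 2)).1 h3
    have h3' : (2 : ℝ) ^ m ≤ 2 ^ μ := by exact_mod_cast h3.le
    have hR : IsReturn C D μ i := by
      refine ⟨x, (y - x).val, hlog1, hlog2, ZMod.val_lt _, ?_, ?_⟩
      · rw [ZMod.natCast_zmod_val, add_sub_cancel]
        have h5 := h.triangle x i y
        rw [h.symm i y] at h5
        have h6 : (8 * C * 2 ^ m : ℝ) ≤ (y - x).val := by exact_mod_cast hxy.le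
        have h7 : D x y ≤ 2 * 2 ^ m := by linarith
        nlinarith
      · rw [h.symm]
        exact hx.trans h3'
    have h5 : T < μ := by
      by_contra! hμT
      exact hret m hm T hT μ h4 hμT hR
    exact (Nat.pow_le_pow_right (by norm_num) h5).trans hlog1
  have hpair : ∀ m ∈ S, ∀ m' ∈ S, m ≠ m' → 2 ^ (T + 1) ≤ (s m' - s m).val := by
    intro m hm m' hm' hne
    rcases lt_or_gt_of_ne hne with hlt | hlt
    · refine hlong m' hm' _ _ ((hs1 m hm).trans ?_) (hs1 m' hm') (hfar m' hm' m hm hlt).2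
      exact pow_le_pow_right₀ (by norm_num) hlt.le
    · refine hlong m hm _ _ (hs1 m hm) ((hs1 m' hm').trans ?_) (hfar m hm m' hm' hlt).1
      exact pow_le_pow_right₀ (by norm_num) hlt.le
  have hTN : 2 ^ T ≤ N := by
    obtain ⟨m, hm, m', hm', hne⟩ := Finset.one_lt_card.1 (show 1 < S.card by omega)
    have h1 := hpair m hm m' hm' hne
    have h2 := ZMod.val_lt (s m' - s m)
    have h3 : 2 ^ (T + 1) = 2 * 2 ^ T := by ring
    omega
  have hlt : ∀ m ∈ S, ∀ m' ∈ S, ∀ x x' : ℕ, x < 2 ^ T → x' ≤ x →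
      s m + (x : ZMod N) = s m' + (x' : ZMod N) → m = m' := by
    intro m hm m' hm' x x' hx hx' hxx
    by_contra hne
    have h1 := hpair m hm m' hm' hne
    have h2 : s m' - s m = ((x - x' : ℕ) : ZMod N) := by
      rw [Nat.cast_sub hx', sub_eq_sub_iff_add_eq_add, ← hxx, add_comm]
    rw [h2] at h1
    have h3 : ((x - x' : ℕ) : ZMod N).val ≤ x - x' := by
      rw [ZMod.val_natCast]
      exact Nat.mod_le _ _
    have h4 : 2 ^ (T + 1) = 2 * 2 ^ T := by ring
    omega
  have hinj := Finset.card_le_card_of_injOn (s := S ×ˢ Finset.range (2 ^ T))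
    (t := Finset.univ.filter fun j => D i j ≤ 2 * 2 ^ T)
    (fun p => s p.1 + (p.2 : ZMod N))
    (fun p hp => by
      simp only [Finset.coe_product, Set.mem_prod, Finset.coe_range, Set.mem_Iio,
        Finset.mem_coe] at hp
      simp only [Finset.coe_filter, Finset.mem_univ, true_and, Set.mem_ofPred_eq]
      have h1 := h.triangle i (s p.1) (s p.1 + (p.2 : ZMod N))
      have h2 := h.le_natCast (s p.1) p.2
      have h3 := hs1 p.1 hp.1
      have h4 : (2 : ℝ) ^ p.1 ≤ 2 ^ T := pow_le_pow_right₀ (by norm_num) (hmax _ hp.1)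
      have h5 : (p.2 : ℝ) ≤ 2 ^ T := by exact_mod_cast hp.2.le
      rw [h.symm i (s p.1)] at h1
      linarith)
    (fun p hp p' hp' hpp => by
      simp only [Finset.coe_product, Set.mem_prod, Finset.coe_range, Set.mem_Iio,
        Finset.mem_coe] at hp hp'
      have h1 : p.1 = p'.1 := by
        rcases le_total p'.2 p.2 with hle | hle
        · exact hlt _ hp.1 _ hp'.1 _ _ hp.2 hle hpp
        · exact (hlt _ hp'.1 _ hp.1 _ _ hp'.2 hle hpp.symm).symm
      simp only [h1, add_right_inj] at hpp
      exact Prod.ext h1 (ZMod.natCast_injOn hTN (by simpa using hp.2) (by simpa using hp'.2) hpp))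
  rw [Finset.card_product, Finset.card_range] at hinj
  have h1 := h.card_ball i (2 * 2 ^ T) (by
    have : (1 : ℝ) ≤ 2 ^ T := one_le_pow₀ (by norm_num)
    linarith)
  have h2 : ((S.card * 2 ^ T : ℕ) : ℝ) ≤ C * (2 * 2 ^ T) := le_trans (by exact_mod_cast hinj) h1
  have h3 : S.card * 2 ^ T ≤ C * (2 * 2 ^ T) := by exact_mod_cast h2
  have h4 : 0 < 2 ^ T := by positivity
  nlinarith

-- Scales are classified by the number of return scales not exceeding them and by their residue
-- modulo `k + 1`. Within a class no return separates two scales and the spacing is at least `k +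
-- 1`, so `card_scales_le` bounds each class.
open Classical in
theorem card_lt_arcGap_le (h : IsRegularTour C D) (i : ZMod N) (k M : ℕ) :
    ((Finset.range M).filter fun m => (1 / 2) ^ (k + 1) * 2 ^ m < arcGap C D m i).card ≤
      2 * C * ((((Finset.range M).filter fun m => IsReturn C D m i).card + 1) * (k + 1)) := by
  set R := (Finset.range M).filter fun m => IsReturn C D m i with hR
  set S := (Finset.range M).filter fun m => (1 / 2) ^ (k + 1) * 2 ^ m < arcGap C D m i with hS
  set f : ℕ → ℕ × ℕ := fun m => ((R.filter fun μ => μ ≤ m).card, m % (k + 1)) with hf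
  have himg : S.image f ⊆ Finset.range (R.card + 1) ×ˢ Finset.range (k + 1) := by
    intro p hp
    obtain ⟨m, -, rfl⟩ := Finset.mem_image.1 hp
    simp only [hf, Finset.mem_product, Finset.mem_range]
    exact ⟨Nat.lt_succ_of_le (Finset.card_filter_le _ _), Nat.mod_lt _ (by omega)⟩
  have h1 := Finset.card_le_mul_card_image (f := f) S (2 * C) (fun b _ => by
    refine h.card_scales_le i k _ (fun m hm => ?_) (fun m hm m' hm' hlt => ?_)
      fun m hm m' hm' μ h1 h2 hμ => ?_
    · exact (Finset.mem_filter.1 (Finset.mem_filter.1 hm).1).2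
    · have h1 := congrArg Prod.snd
        ((Finset.mem_filter.1 hm).2.trans (Finset.mem_filter.1 hm').2.symm)
      simp only [hf] at h1
      have h2 : (k + 1) ∣ m - m' := (Nat.modEq_iff_dvd' hlt.le).1 h1.symm
      have := Nat.le_of_dvd (by omega) h2
      omega
    · have h3 := congrArg Prod.fst
        ((Finset.mem_filter.1 hm).2.trans (Finset.mem_filter.1 hm').2.symm)
      simp only [hf] at h3
      have hμR : μ ∈ R := by
        have := Finset.mem_range.1 (Finset.mem_filter.1 (Finset.mem_filter.1 hm').1).1
        exact Finset.mem_filter.2 ⟨Finset.mem_range.2 (by omega), hμ⟩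
      have h4 : (R.filter fun μ => μ ≤ m) ⊂ R.filter fun μ => μ ≤ m' := by
        refine (Finset.ssubset_iff_of_subset fun ν hν => ?_).2 ⟨μ, ?_, ?_⟩
        · have := Finset.mem_filter.1 hν
          exact Finset.mem_filter.2 ⟨this.1, by omega⟩
        · exact Finset.mem_filter.2 ⟨hμR, h2⟩
        · intro hmem
          have := (Finset.mem_filter.1 hmem).2
          omega
      exact (Finset.card_lt_card h4).ne h3)
  refine h1.trans (Nat.mul_le_mul_left _ ?_)
  have := Finset.card_le_card himg
  rwa [Finset.card_product, Finset.card_range, Finset.card_range] at this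

-- Thresholds `2 ^ (-k - 1)` cost a factor `k + 1` in the number of scales, which is summable
-- against `2 ^ (-k)`. The constant `9` is `2 * 4` from that series plus `1` for the truncation
-- error.
open Classical in
theorem sum_arcGap_div_le (h : IsRegularTour C D) (i : ZMod N) (M : ℕ) :
    ∑ m ∈ Finset.range M, arcGap C D m i / 2 ^ m ≤
      9 * C * (((Finset.range M).filter fun m => IsReturn C D m i).card + 1) := by
  set R : ℝ := (((Finset.range M).filter fun m => IsReturn C D m i).card : ℝ) with hR
  have hR0 : 0 ≤ R := by positivity
  have hC1 : (1 : ℝ) ≤ C := by exact_mod_cast h.one_le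
  have h1 : ∀ m ∈ Finset.range M, arcGap C D m i / 2 ^ m ≤ (1 / 2) ^ M +
      ∑ k ∈ Finset.range M, (1 / 2 : ℝ) ^ k *
        (if (1 / 2 : ℝ) ^ (k + 1) < arcGap C D m i / 2 ^ m then 1 else 0) := fun m _ =>
    le_sum_dyadic _ (by rw [div_le_one (by positivity)]; exact arcGap_le m i) M
  refine (Finset.sum_le_sum h1).trans ?_
  rw [Finset.sum_add_distrib, Finset.sum_comm]
  have h2 : ∑ _m ∈ Finset.range M, (1 / 2 : ℝ) ^ M ≤ 1 := by
    rw [Finset.sum_const, Finset.card_range, nsmul_eq_mul, one_div, inv_pow,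
      ← div_eq_mul_inv, div_le_one (by positivity)]
    exact_mod_cast Nat.lt_two_pow_self.le
  have h3 : ∀ k ∈ Finset.range M, ∑ m ∈ Finset.range M, (1 / 2 : ℝ) ^ k *
        (if (1 / 2 : ℝ) ^ (k + 1) < arcGap C D m i / 2 ^ m then 1 else 0) ≤
      2 * C * (R + 1) * ((1 / 2 : ℝ) ^ k * (k + 1)) := by
    intro k _
    rw [← Finset.mul_sum, ← Finset.sum_filter, Finset.sum_const, nsmul_eq_mul, mul_one]
    have h4 := h.card_lt_arcGap_le i k M
    simp_rw [lt_div_iff₀ (show (0 : ℝ) < 2 ^ _ by positivity)]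
    have h5 : ((((Finset.range M).filter fun m =>
        (1 / 2) ^ (k + 1) * 2 ^ m < arcGap C D m i).card : ℕ) : ℝ) ≤
        2 * C * ((R + 1) * (k + 1)) := by
      rw [hR]
      exact_mod_cast h4
    calc _ ≤ (1 / 2 : ℝ) ^ k * (2 * C * ((R + 1) * (k + 1))) := by gcongr
      _ = _ := by ring
  have h4 := Finset.sum_le_sum h3
  rw [← Finset.mul_sum] at h4
  have h5 := mul_le_mul_of_nonneg_left (sum_succ_mul_pow_half_le M)
    (show 0 ≤ 2 * C * (R + 1) by positivity)
  have h6 : 1 ≤ C * (R + 1) := by nlinarith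
  linarith

theorem sum_sum_arcGap_div_le (h : IsRegularTour C D) (M : ℕ) :
    ∑ m ∈ Finset.range M, ∑ i, arcGap C D m i / 2 ^ m ≤ 2 ^ 31 * C ^ 6 * N := by
  classical
  have hC1 : (1 : ℝ) ≤ C := by exact_mod_cast h.one_le
  rw [Finset.sum_comm]
  refine (Finset.sum_le_sum fun i _ => h.sum_arcGap_div_le i M).trans ?_
  rw [← Finset.mul_sum, Finset.sum_add_distrib]
  have h1 : ∑ i : ZMod N, (((Finset.range M).filter fun m => IsReturn C D m i).card : ℝ) =
      ∑ m ∈ Finset.range M, ((Finset.univ.filter fun i => IsReturn C D m i).card : ℝ) := by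
    simp_rw [Finset.card_filter]
    push_cast
    exact Finset.sum_comm
  rw [h1]
  have h2 := h.sum_card_isReturn_le M
  have h3 : (1 : ℝ) ≤ C ^ 5 := one_le_pow₀ hC1
  have h4 : ∑ _i : ZMod N, (1 : ℝ) = N := by simp
  rw [h4]
  have hN : (0 : ℝ) ≤ N := by positivity
  calc _ ≤ 9 * (C : ℝ) * (2 ^ 27 * C ^ 5 * N + C ^ 5 * N) := by gcongr; nlinarith
    _ = 9 * (2 ^ 27 + 1) * ((C : ℝ) ^ 6 * N) := by ring
    _ ≤ 2 ^ 31 * ((C : ℝ) ^ 6 * N) := by gcongr; norm_num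
    _ = _ := by ring

end IsRegularTour

/-! ### From triples on one arc to all triples at a scale. -/

/-- The square splits along the diagonal; each half is reparametrised by the smaller entry and the
difference. This passes from two offsets measured from a base point to two consecutive steps. -/
theorem sum_sq_le_two_mul_of_symm (G F : ℕ → ℕ → ℝ) (hF : ∀ a b, 0 ≤ F a b)
    (hG : ∀ a b, G a b = G b a) (hGF : ∀ a b, G a (a + b) ≤ F a b) (K : ℕ) :
    ∑ a ∈ Finset.range K, ∑ b ∈ Finset.range K, G a b ≤
      2 * ∑ a ∈ Finset.range K, ∑ b ∈ Finset.range K, F a b := by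
  rw [← Finset.sum_product', ← Finset.sum_product']
  set P := Finset.range K ×ˢ Finset.range K with hP
  rw [← Finset.sum_filter_add_sum_filter_not P (fun p => p.1 ≤ p.2)]
  have h1 : ∑ p ∈ P.filter (fun p => p.1 ≤ p.2), G p.1 p.2 ≤ ∑ p ∈ P, F p.1 p.2 := by
    refine le_trans (Finset.sum_le_sum fun p hp => ?_)
      (sum_comp_le_of_injOn (s := P.filter (fun p => p.1 ≤ p.2)) (t := P)
        (f := fun p : ℕ × ℕ => F p.1 p.2) (fun p : ℕ × ℕ => (p.1, p.2 - p.1))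
        (fun p => hF _ _) (fun p hp => ?_) (fun p hp q hq hpq => ?_))
    · have h2 := hGF p.1 (p.2 - p.1)
      rwa [Nat.add_sub_cancel' (Finset.mem_filter.1 hp).2] at h2
    · simp only [hP, Finset.mem_filter, Finset.mem_product, Finset.mem_range] at hp ⊢
      omega
    · simp only [Finset.coe_filter, Set.mem_ofPred_eq] at hp hq
      simp only [Prod.mk.injEq] at hpq
      ext <;> omega
  have h2 : ∑ p ∈ P.filter (fun p => ¬ p.1 ≤ p.2), G p.1 p.2 ≤ ∑ p ∈ P, F p.1 p.2 := by
    refine le_trans (Finset.sum_le_sum fun p hp => ?_)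
      (sum_comp_le_of_injOn (s := P.filter (fun p => ¬ p.1 ≤ p.2)) (t := P)
        (f := fun p : ℕ × ℕ => F p.1 p.2) (fun p : ℕ × ℕ => (p.2, p.1 - p.2))
        (fun p => hF _ _) (fun p hp => ?_) (fun p hp q hq hpq => ?_))
    · have h2 := hGF p.2 (p.1 - p.2)
      rw [Nat.add_sub_cancel' (not_le.1 (Finset.mem_filter.1 hp).2).le, hG] at h2
      exact h2
    · simp only [hP, Finset.mem_filter, Finset.mem_product, Finset.mem_range] at hp ⊢
      omega
    · simp only [Finset.coe_filter, Set.mem_ofPred_eq] at hp hq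
      simp only [Prod.mk.injEq] at hpq
      ext <;> omega
  linarith

theorem sum_tourArc_le {N : ℕ} [NeZero N] (f : ZMod N → ℝ) (hf : ∀ t, 0 ≤ f t) (s : ZMod N)
    (K : ℕ) : ∑ t ∈ tourArc s K, f t ≤ ∑ a ∈ Finset.range (K + 1), (f (s + a) + f (s - a)) := by
  classical
  rw [tourArc, Finset.filter_or, Finset.sum_add_distrib]
  refine (le_trans (le_add_of_nonneg_right (Finset.sum_nonneg fun t _ => hf t))
    (Finset.sum_union_inter).le).trans (add_le_add ?_ ?_)
  · refine le_trans (le_of_eq (Finset.sum_congr rfl fun t _ => ?_))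
      (sum_comp_le_of_injOn (f := fun a : ℕ => f (s + a)) (fun t : ZMod N => (t - s).val)
        (fun a => hf _) (fun t ht => ?_) (fun t _ t' _ htt => ?_))
    · simp
    · simpa [Nat.lt_succ_iff] using ht
    · exact sub_left_injective (ZMod.val_injective N htt)
  · refine le_trans (le_of_eq (Finset.sum_congr rfl fun t _ => ?_))
      (sum_comp_le_of_injOn (f := fun a : ℕ => f (s - a)) (fun t : ZMod N => (s - t).val)
        (fun a => hf _) (fun t ht => ?_) (fun t _ t' _ htt => ?_))
    · simp
    · simpa [Nat.lt_succ_iff] using ht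
    · exact sub_right_injective (ZMod.val_injective N htt)

namespace IsRegularTour

variable {N : ℕ} [NeZero N] {C : ℕ} {D : ZMod N → ZMod N → ℝ}

theorem sum_tourExcess_range_succ (h : IsRegularTour C D) (K : ℕ) :
    ∑ a ∈ Finset.range (K + 1), ∑ b ∈ Finset.range (K + 1), tourExcess D a b =
      ∑ x ∈ Finset.range K, ∑ y ∈ Finset.range K, tourExcess D (x + 1) (y + 1) := by
  have h0 : ∀ b, tourExcess D 0 b = 0 := fun b => by
    simp [tourExcess, excess, h.self]
  have h1 : ∀ a, tourExcess D a 0 = 0 := fun b => by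
    simp [tourExcess, excess, h.self]
  rw [Finset.sum_range_succ']
  simp_rw [Finset.sum_range_succ' _ K, h0, h1]
  simp

/-- The two points of the arc are at signed offsets from `s`. In each of the four sign patterns the
point lying in the middle along the tour is taken as middle point, and a cyclic shift gives an
ordered triple. Equal signs cost a factor `2`, opposite signs `1`, in total `6`. -/
theorem sum_minExcess_tourArc_le (h : IsRegularTour C D) (K : ℕ) :
    ∑ s, ∑ t ∈ tourArc s K, ∑ u ∈ tourArc s K, minExcess D s t u ≤
      6 * ∑ x ∈ Finset.range K, ∑ y ∈ Finset.range K, tourExcess D (x + 1) (y + 1) := by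
  rw [← h.sum_tourExcess_range_succ]
  set R := Finset.range (K + 1)
  have e1 : ∀ s : ZMod N, ∑ t ∈ tourArc s K, ∑ u ∈ tourArc s K, minExcess D s t u ≤
      ∑ a ∈ R, ∑ b ∈ R, (minExcess D s (s + a) (s + b) + minExcess D s (s + a) (s - b) +
        (minExcess D s (s - a) (s + b) + minExcess D s (s - a) (s - b))) := by
    intro s
    refine (sum_tourArc_le _ (fun t => Finset.sum_nonneg fun u _ => h.minExcess_nonneg _ _ _)
      s K).trans (Finset.sum_le_sum fun a _ => ?_)
    rw [Finset.sum_add_distrib]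
    exact add_le_add (sum_tourArc_le _ (fun u => h.minExcess_nonneg _ _ _) s K)
      (sum_tourArc_le _ (fun u => h.minExcess_nonneg _ _ _) s K)
  refine (Finset.sum_le_sum fun s _ => e1 s).trans ?_
  have e2 : ∀ F : ZMod N → ℕ → ℕ → ℝ, ∑ s, ∑ a ∈ R, ∑ b ∈ R, F s a b =
      ∑ a ∈ R, ∑ b ∈ R, ∑ s, F s a b := fun F => by
    rw [Finset.sum_comm]
    exact Finset.sum_congr rfl fun a _ => Finset.sum_comm
  rw [e2]
  simp_rw [Finset.sum_add_distrib]
  have hpos := h.tourExcess_nonneg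
  have h1 : ∑ a ∈ R, ∑ b ∈ R, ∑ s, minExcess D s (s + a) (s + b) ≤
      2 * ∑ a ∈ R, ∑ b ∈ R, tourExcess D a b := by
    refine sum_sq_le_two_mul_of_symm (fun a b => ∑ s, minExcess D s (s + a) (s + b))
      (tourExcess D) hpos
      (fun a b => Finset.sum_congr rfl fun s _ => h.minExcess_swap _ _ _)
      (fun a b => Finset.sum_le_sum fun s _ => ?_) _
    have := minExcess_le_left D s (s + a) (s + (a + b : ℕ))
    rwa [Nat.cast_add, ← add_assoc] at this ⊢
  have h4 : ∑ a ∈ R, ∑ b ∈ R, ∑ s, minExcess D s (s - a) (s - b) ≤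
      2 * ∑ a ∈ R, ∑ b ∈ R, tourExcess D b a := by
    refine sum_sq_le_two_mul_of_symm (fun a b => ∑ s, minExcess D s (s - a) (s - b))
      (fun a b => tourExcess D b a) (fun a b => hpos b a)
      (fun a b => Finset.sum_congr rfl fun s _ => h.minExcess_swap _ _ _) (fun a b => ?_) _
    rw [← ZMod.sum_add_right _ ((a + b : ℕ) : ZMod N)]
    refine Finset.sum_le_sum fun s _ => ?_
    have := minExcess_le_left D (s + (a + b : ℕ)) (s + b) s
    rw [h.excess_rev] at this
    rw [show s + ((a + b : ℕ) : ZMod N) - a = s + b by push_cast; ring,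
      add_sub_cancel_right]
    rw [show s + ((a + b : ℕ) : ZMod N) = s + b + a by push_cast; ring] at this ⊢
    exact this
  have h3 : ∑ a ∈ R, ∑ b ∈ R, ∑ s, minExcess D s (s - a) (s + b) ≤
      ∑ a ∈ R, ∑ b ∈ R, tourExcess D a b := by
    refine Finset.sum_le_sum fun a _ => Finset.sum_le_sum fun b _ => ?_
    rw [← ZMod.sum_add_right _ (a : ZMod N)]
    refine Finset.sum_le_sum fun s _ => ?_
    rw [add_sub_cancel_right]
    have := minExcess_le_first D (s + a) s (s + a + b)
    rw [h.excess_rev] at this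
    have h5 := minExcess_le_first D (s + a) (s + a + b) s
    rw [h.minExcess_swap] at h5
    exact h5
  have h2 : ∑ a ∈ R, ∑ b ∈ R, ∑ s, minExcess D s (s + a) (s - b) ≤
      ∑ a ∈ R, ∑ b ∈ R, tourExcess D a b := by
    refine le_trans (le_of_eq ?_) h3
    rw [Finset.sum_comm]
    exact Finset.sum_congr rfl fun a _ => Finset.sum_congr rfl fun b _ =>
      Finset.sum_congr rfl fun s _ => h.minExcess_swap _ _ _
  have h5 : ∑ a ∈ R, ∑ b ∈ R, tourExcess D b a = ∑ a ∈ R, ∑ b ∈ R, tourExcess D a b :=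
    Finset.sum_comm
  linarith

/-- The excess of a triple is controlled by the distances of two of its points to an arc around
the third one and by an average of the excess over the triples on this arc near the given one. -/
theorem minExcess_le_sum_tourArc (h : IsRegularTour C D) {s j k : ZMod N} {m : ℕ}
    (hj : D s j ≤ 2 ^ m) :
    minExcess D s j k ≤
      16 * (arcDist D s (8 * C * 2 ^ m) j + arcDist D s (8 * C * 2 ^ m) k) +
      1152 * ∑ t ∈ tourArc s ((8 * C + 1) * 2 ^ m), ∑ u ∈ tourArc s ((8 * C + 1) * 2 ^ m),
        if D t j ≤ max 1 (minExcess D s t u) ∧ D u k ≤ max 1 (minExcess D s t u) then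
          minExcess D s t u / max 1 (minExcess D s t u) ^ 2 else 0 := by
  set F : ZMod N × ZMod N → ℝ := fun p =>
    if D p.1 j ≤ max 1 (minExcess D s p.1 p.2) ∧ D p.2 k ≤ max 1 (minExcess D s p.1 p.2) then
      minExcess D s p.1 p.2 / max 1 (minExcess D s p.1 p.2) ^ 2 else 0 with hF
  have hF0 : ∀ p, 0 ≤ F p := fun p => by
    have := h.minExcess_nonneg s p.1 p.2
    simp only [hF]
    split_ifs <;> positivity
  set A := tourArc s ((8 * C + 1) * 2 ^ m) with hA
  change _ ≤ _ + 1152 * ∑ t ∈ A, ∑ u ∈ A, F (t, u)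
  rw [← Finset.sum_product]
  set d := minExcess D s j k with hd
  have hd0 : 0 ≤ d := h.minExcess_nonneg _ _ _
  have hS : 0 ≤ ∑ p ∈ A ×ˢ A, F p := Finset.sum_nonneg fun p _ => hF0 p
  have hj0 := h.arcDist_nonneg s (8 * C * 2 ^ m) j
  have hk0 := h.arcDist_nonneg s (8 * C * 2 ^ m) k
  by_cases hle : d ≤ 16 * (arcDist D s (8 * C * 2 ^ m) j + arcDist D s (8 * C * 2 ^ m) k)
  · linarith
  rw [not_le] at hle
  have hdpos : 0 < d := by linarith
  have hd2 : d ≤ 2 * 2 ^ m := (h.minExcess_le_two_mul s j k).trans (by linarith)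
  have hdN : d < 2 * N := (h.minExcess_le_two_mul s j k).trans_lt (by
    linarith [h.lt_card s j])
  obtain ⟨t₀, ht₀, ht₀'⟩ := Finset.exists_mem_eq_inf' ⟨s, self_mem_tourArc s (8 * C * 2 ^ m)⟩
    fun t => D t j
  obtain ⟨u₀, hu₀, hu₀'⟩ := Finset.exists_mem_eq_inf' ⟨s, self_mem_tourArc s (8 * C * 2 ^ m)⟩
    fun t => D t k
  change arcDist D s (8 * C * 2 ^ m) j = D t₀ j at ht₀'
  change arcDist D s (8 * C * 2 ^ m) k = D u₀ k at hu₀'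
  rw [ht₀', hu₀'] at hle
  rw [ht₀'] at hj0
  rw [hu₀'] at hk0
  -- Now the excess `d` dominates the distances of `j` and `k` to their nearest arc points `t₀`,
  -- `u₀`. Moving these by at most `n ≤ d / 16` steps away from `s` stays in the enlarged arc and
  -- changes the excess by at most `d / 2`, so `(n + 1) ^ 2` arc triples have excess comparable to
  -- `d`.
  set n := ⌊d / 16⌋₊ with hn
  have hn1 : (n : ℝ) ≤ d / 16 := Nat.floor_le (by positivity)
  have hn2 : d / 16 < n + 1 := Nat.lt_floor_add_one _
  have hnN : n + 1 ≤ N := by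
    have : (n : ℝ) < N := by linarith
    exact_mod_cast this
  have hnm : n ≤ 2 ^ m := by
    have : (n : ℝ) ≤ 2 ^ m := by linarith
    exact_mod_cast this
  have hgood : ∀ t ∈ tourArc s (8 * C * 2 ^ m), ∃ g : ℕ → ZMod N, (∀ x ∈ Finset.range (n + 1),
      g x ∈ A ∧ D (g x) t ≤ d / 16) ∧ Set.InjOn g (Finset.range (n + 1)) := by
    intro t ht
    have hb : ∀ x ∈ Finset.range (n + 1), (x : ℝ) ≤ d / 16 := fun x hx => by
      have : x ≤ n := by rw [Finset.mem_range] at hx; omega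
      exact le_trans (by exact_mod_cast this) hn1
    simp only [tourArc, Finset.mem_filter, Finset.mem_univ, true_and] at ht
    have hval : ∀ x : ℕ, (x : ZMod N).val ≤ x := fun x => by
      rw [ZMod.val_natCast]; exact Nat.mod_le _ _
    have hK : (8 * C + 1) * 2 ^ m = 8 * C * 2 ^ m + 2 ^ m := by ring
    rcases ht with ht | ht
    · refine ⟨fun x => t + (x : ZMod N), fun x hx => ⟨?_, ?_⟩,
        fun x hx x' hx' hxx => ZMod.natCast_injOn hnN hx hx' (add_right_injective _ hxx)⟩
      · have hxn := Finset.mem_range.1 hx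
        simp only [tourArc, Finset.mem_filter, Finset.mem_univ, true_and, hA]
        left
        rw [add_sub_right_comm, hK]
        exact (ZMod.val_add_le _ _).trans (add_le_add ht ((hval x).trans (by omega)))
      · rw [h.symm]
        exact (h.le_natCast t x).trans (hb x hx)
    · refine ⟨fun x => t - (x : ZMod N), fun x hx => ⟨?_, ?_⟩,
        fun x hx x' hx' hxx => ZMod.natCast_injOn hnN hx hx' (sub_right_injective hxx)⟩
      · have hxn := Finset.mem_range.1 hx
        simp only [tourArc, Finset.mem_filter, Finset.mem_univ, true_and, hA]
        right
        rw [sub_sub_eq_add_sub, add_sub_right_comm, hK]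
        exact (ZMod.val_add_le _ _).trans (add_le_add ht ((hval x).trans (by omega)))
      · rw [h.symm]
        exact (h.le_natCast' t x).trans (hb x hx)
  obtain ⟨g, hg1, hg2⟩ := hgood t₀ ht₀
  obtain ⟨g', hg1', hg2'⟩ := hgood u₀ hu₀
  have key := sum_comp_le_of_injOn (s := Finset.range (n + 1) ×ˢ Finset.range (n + 1))
    (t := A ×ˢ A) (f := F) (fun p => (g p.1, g' p.2)) hF0
    (fun p hp => by
      rw [Finset.mem_product] at hp ⊢
      exact ⟨(hg1 _ hp.1).1, (hg1' _ hp.2).1⟩)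
    (fun p hp q hq hpq => by
      simp only [Finset.coe_product, Set.mem_prod] at hp hq
      simp only [Prod.mk.injEq] at hpq
      exact Prod.ext (hg2 hp.1 hq.1 hpq.1) (hg2' hp.2 hq.2 hpq.2))
  -- The new excess is at most `3 / 2 * d < 24 * (n + 1)`; the constant `1152` is `2 * 24 ^ 2`.
  have hterm : ∀ p ∈ Finset.range (n + 1) ×ˢ Finset.range (n + 1),
      (d / 2) / (24 * (n + 1)) ^ 2 ≤ F (g p.1, g' p.2) := by
    intro p hp
    rw [Finset.mem_product] at hp
    have h1 := (hg1 _ hp.1).2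
    have h2 := (hg1' _ hp.2).2
    have h3 := h.triangle (g p.1) t₀ j
    have h4 := h.triangle (g' p.2) u₀ k
    have h5 := h.minExcess_le_add s j k s (g p.1) (g' p.2)
    have h6 := h.minExcess_le_add s (g p.1) (g' p.2) s j k
    rw [h.self, h.symm j, h.symm k] at h5
    rw [h.self] at h6
    set e := minExcess D s (g p.1) (g' p.2) with he
    have h7 : d / 2 ≤ e := by linarith
    have h8 : e ≤ 3 / 2 * d := by linarith
    have h9 : d / 2 ≤ max 1 e := h7.trans (le_max_right _ _)
    have h10 : max 1 e ≤ 24 * (n + 1) := max_le (by linarith [(Nat.cast_nonneg n : (0 : ℝ) ≤ n)])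
      (by linarith)
    have h11 : (0 : ℝ) < max 1 e := lt_max_of_lt_left one_pos
    simp only [hF]
    rw [if_pos ⟨by linarith, by linarith⟩]
    refine div_le_div₀ (by linarith) h7 (by positivity) ?_
    gcongr
  have h9 := (Finset.card_nsmul_le_sum _ _ _ hterm).trans key
  simp only [Finset.card_product, Finset.card_range, nsmul_eq_mul] at h9
  have h10 : (((n + 1) * (n + 1) : ℕ) : ℝ) * ((d / 2) / (24 * (n + 1)) ^ 2) = d / 1152 := by
    push_cast
    field_simp
    norm_num
  rw [h10] at h9
  linarith

theorem card_ball' (h : IsRegularTour C D) (i : ZMod N) (R : ℝ) (hR : 1 ≤ R) :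
    ((Finset.univ.filter fun j => D j i ≤ R).card : ℝ) ≤ C * R := by
  simp_rw [h.symm _ i]
  exact h.card_ball i R hR

theorem sum_minExcess_scale_le (h : IsRegularTour C D) (m : ℕ) :
    ∑ s, ∑ j ∈ Finset.univ.filter (fun j => D s j ≤ 2 ^ m),
      ∑ k ∈ Finset.univ.filter (fun k => D s k ≤ 2 ^ m), minExcess D s j k ≤
    32 * C ^ 2 * 4 ^ m * ∑ j, arcGap C D m j +
      6912 * C ^ 2 * ∑ x ∈ Finset.range ((8 * C + 1) * 2 ^ m),
        ∑ y ∈ Finset.range ((8 * C + 1) * 2 ^ m), tourExcess D (x + 1) (y + 1) := by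
  set B : ZMod N → Finset (ZMod N) := fun s => Finset.univ.filter (fun j => D s j ≤ 2 ^ m) with hB
  set A : ZMod N → Finset (ZMod N) := fun s => tourArc s ((8 * C + 1) * 2 ^ m) with hA
  have hm1 : (1 : ℝ) ≤ 2 ^ m := one_le_pow₀ (by norm_num)
  have hBcard : ∀ s, ((B s).card : ℝ) ≤ C * 2 ^ m := fun s => h.card_ball s _ hm1
  have hgap := fun j => h.arcGap_nonneg m j
  have h1 : ∀ s, ∑ j ∈ B s, ∑ k ∈ B s, minExcess D s j k ≤
      32 * (C * 2 ^ m) * ∑ j ∈ B s, arcGap C D m j +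
        1152 * C ^ 2 * ∑ t ∈ A s, ∑ u ∈ A s, minExcess D s t u := by
    intro s
    have h2 : ∀ j ∈ B s, ∀ k ∈ B s, minExcess D s j k ≤ 16 * (arcGap C D m j + arcGap C D m k) +
        1152 * ∑ t ∈ A s, ∑ u ∈ A s,
        if D t j ≤ max 1 (minExcess D s t u) ∧ D u k ≤ max 1 (minExcess D s t u) then
          minExcess D s t u / max 1 (minExcess D s t u) ^ 2 else 0 := by
      intro j hj k hk
      have hj' := (Finset.mem_filter.1 hj).2
      have hk' := (Finset.mem_filter.1 hk).2
      have h3 := h.minExcess_le_sum_tourArc (k := k) hj'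
      have h4 := arcDist_le_arcGap (C := C) hj'
      have h5 := arcDist_le_arcGap (C := C) hk'
      linarith
    refine (Finset.sum_le_sum fun j hj => Finset.sum_le_sum fun k hk => h2 j hj k hk).trans ?_
    simp_rw [Finset.sum_add_distrib, ← Finset.mul_sum, Finset.sum_add_distrib, Finset.sum_const,
      nsmul_eq_mul, ← Finset.mul_sum]
    have hG : 0 ≤ ∑ j ∈ B s, arcGap C D m j := Finset.sum_nonneg fun j _ => hgap j
    have h3 := mul_le_mul_of_nonneg_right (hBcard s) hG
    have h4 : ∑ j ∈ B s, ∑ k ∈ B s, ∑ t ∈ A s, ∑ u ∈ A s,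
        (if D t j ≤ max 1 (minExcess D s t u) ∧ D u k ≤ max 1 (minExcess D s t u) then
          minExcess D s t u / max 1 (minExcess D s t u) ^ 2 else 0) ≤
        C ^ 2 * ∑ t ∈ A s, ∑ u ∈ A s, minExcess D s t u := by
      have e0 : ∀ F : ZMod N → ZMod N → ZMod N → ℝ, ∑ j ∈ B s, ∑ k ∈ B s, ∑ t ∈ A s, F j k t =
          ∑ t ∈ A s, ∑ j ∈ B s, ∑ k ∈ B s, F j k t := fun F =>
        (Finset.sum_congr rfl fun j _ => Finset.sum_comm).trans Finset.sum_comm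
      have e1 : ∀ F : ZMod N → ZMod N → ZMod N → ZMod N → ℝ,
          ∑ j ∈ B s, ∑ k ∈ B s, ∑ t ∈ A s, ∑ u ∈ A s, F j k t u =
          ∑ t ∈ A s, ∑ u ∈ A s, ∑ j ∈ B s, ∑ k ∈ B s, F j k t u := fun F => by
        exact (e0 _).trans (Finset.sum_congr rfl fun t _ => e0 _)
      rw [e1, Finset.mul_sum]
      refine Finset.sum_le_sum fun t _ => ?_
      rw [Finset.mul_sum]
      refine Finset.sum_le_sum fun u _ => ?_
      set e := minExcess D s t u with he
      have he0 : 0 ≤ e := h.minExcess_nonneg _ _ _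
      have hw1 : 1 ≤ max 1 e := le_max_left _ _
      rw [← Finset.sum_product', ← Finset.sum_filter, Finset.sum_const, nsmul_eq_mul]
      have h5 : ((B s ×ˢ B s).filter fun p => D t p.1 ≤ max 1 e ∧ D u p.2 ≤ max 1 e) ⊆
          (Finset.univ.filter fun j => D t j ≤ max 1 e) ×ˢ
            (Finset.univ.filter fun k => D u k ≤ max 1 e) := by
        intro p hp
        have := (Finset.mem_filter.1 hp).2
        exact Finset.mem_product.2 ⟨Finset.mem_filter.2 ⟨Finset.mem_univ _, this.1⟩,
          Finset.mem_filter.2 ⟨Finset.mem_univ _, this.2⟩⟩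
      -- For a fixed arc triple of excess `e`, at most `(C * max 1 e) ^ 2` pairs `(j, k)` are
      -- charged to it. The denominator in the average cancels this count, and the `1` in the
      -- maximum keeps the radius admissible in `card_ball`.
      have h6 : (((B s ×ˢ B s).filter fun p => D t p.1 ≤ max 1 e ∧ D u p.2 ≤ max 1 e).card : ℝ) ≤
          (C * max 1 e) * (C * max 1 e) := by
        refine le_trans (Nat.cast_le.2 (Finset.card_le_card h5)) ?_
        rw [Finset.card_product, Nat.cast_mul]
        exact mul_le_mul (h.card_ball t _ hw1) (h.card_ball u _ hw1) (by positivity)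
          (by positivity)
      calc _ ≤ (C * max 1 e) * (C * max 1 e) * (e / max 1 e ^ 2) := by gcongr
        _ = C ^ 2 * e := by field_simp
    linarith
  refine (Finset.sum_le_sum fun s _ => h1 s).trans ?_
  rw [Finset.sum_add_distrib, ← Finset.mul_sum, ← Finset.mul_sum]
  have h2 : ∑ s, ∑ j ∈ B s, arcGap C D m j ≤ C * 2 ^ m * ∑ j, arcGap C D m j := by
    simp_rw [hB, Finset.sum_filter]
    rw [Finset.sum_comm, Finset.mul_sum]
    refine Finset.sum_le_sum fun j _ => ?_
    rw [← Finset.sum_filter, Finset.sum_const, nsmul_eq_mul]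
    exact mul_le_mul_of_nonneg_right (h.card_ball' j _ hm1) (hgap j)
  have h3 := h.sum_minExcess_tourArc_le ((8 * C + 1) * 2 ^ m)
  refine add_le_add ?_ ?_
  · refine (mul_le_mul_of_nonneg_left h2 (by positivity)).trans (le_of_eq ?_)
    rw [show (4 : ℝ) = 2 ^ 2 by norm_num, ← pow_mul, mul_comm 2 m, pow_mul]
    ring
  · refine (mul_le_mul_of_nonneg_left h3 (by positivity)).trans (le_of_eq ?_)
    ring

end IsRegularTour

/-! ### Summation over all scales. -/

theorem sum_filter_pow_half_le (ξ : ℝ) (hξ : 0 ≤ ξ) (M : ℕ) :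
    ∑ m ∈ (Finset.range M).filter (fun m => (1 / 2 : ℝ) ^ m ≤ ξ), (1 / 8 : ℝ) ^ m ≤
      2 * ξ ^ 3 := by
  rcases ((Finset.range M).filter
    (fun m => (1 / 2 : ℝ) ^ m ≤ ξ)).eq_empty_or_nonempty with he | he
  · rw [he, Finset.sum_empty]
    positivity
  · obtain ⟨l, hl, hmin⟩ := Finset.exists_min_image _ id he
    have hl' := (Finset.mem_filter.1 hl).2
    have h1 : (Finset.range M).filter (fun m => (1 / 2 : ℝ) ^ m ≤ ξ) ⊆ Finset.Ico l M :=
      fun m hm => Finset.mem_Ico.2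
        ⟨hmin m hm, Finset.mem_range.1 (Finset.mem_filter.1 hm).1⟩
    refine (Finset.sum_le_sum_of_subset_of_nonneg h1 fun _ _ _ => by positivity).trans ?_
    refine (geom_sum_Ico_le_of_lt_one (by norm_num) (by norm_num)).trans ?_
    have h2 : ((1 / 2 : ℝ) ^ l) ^ 3 ≤ ξ ^ 3 := by gcongr
    rw [← pow_mul, mul_comm, pow_mul] at h2
    norm_num at h2 ⊢
    have : (0 : ℝ) ≤ (1 / 8) ^ l := by positivity
    linarith

namespace IsRegularTour

variable {N : ℕ} [NeZero N] {C : ℕ} {D : ZMod N → ZMod N → ℝ}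

/-- A pair of steps contributes only at scales with `2 ^ m` at least its total length over `3 * K`.
The geometric series of `8 ^ (-m)` over these scales recovers the inverse cube of the length, with
constant `2 * 3 ^ 3 = 54`. -/
theorem sum_pow_mul_tourExcess_le (h : IsRegularTour C D) (K M : ℕ) :
    ∑ m ∈ Finset.range M, (1 / 8 : ℝ) ^ m * ∑ x ∈ Finset.range (K * 2 ^ m),
        ∑ y ∈ Finset.range (K * 2 ^ m), tourExcess D (x + 1) (y + 1) ≤ 54 * K ^ 3 * N := by
  set P := Finset.range (K * 2 ^ M) ×ˢ Finset.range (K * 2 ^ M) with hP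
  have h1 : ∀ m ∈ Finset.range M, (1 / 8 : ℝ) ^ m * ∑ x ∈ Finset.range (K * 2 ^ m),
        ∑ y ∈ Finset.range (K * 2 ^ m), tourExcess D (x + 1) (y + 1) ≤
      ∑ p ∈ P, if (1 / 2 : ℝ) ^ m ≤ 3 * K / ((p.1 : ℝ) + p.2 + 3) then
        (1 / 8 : ℝ) ^ m * tourExcess D (p.1 + 1) (p.2 + 1) else 0 := by
    intro m hm
    rw [← Finset.sum_product', Finset.mul_sum, ← Finset.sum_filter]
    refine Finset.sum_le_sum_of_subset_of_nonneg (fun p hp => ?_) fun p _ _ =>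
      mul_nonneg (by positivity) (h.tourExcess_nonneg _ _)
    simp only [Finset.mem_product, Finset.mem_range] at hp
    have h2 : K * 2 ^ m ≤ K * 2 ^ M := Nat.mul_le_mul_left _
      (Nat.pow_le_pow_right (by norm_num) (Finset.mem_range.1 hm).le)
    simp only [hP, Finset.mem_filter, Finset.mem_product, Finset.mem_range]
    refine ⟨⟨by omega, by omega⟩, ?_⟩
    have h3 : p.1 + p.2 + 3 ≤ 3 * (K * 2 ^ m) := by omega
    have h4 : (p.1 : ℝ) + p.2 + 3 ≤ 3 * (K * 2 ^ m) := by exact_mod_cast h3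
    rw [one_div, inv_pow, le_div_iff₀ (by positivity), inv_mul_le_iff₀ (by positivity)]
    linarith
  refine (Finset.sum_le_sum h1).trans ?_
  rw [Finset.sum_comm]
  have h2 := h.sum_tourExcess_div_le (K * 2 ^ M)
  rw [← Finset.sum_product', ← hP] at h2
  refine le_trans ?_ (mul_le_mul_of_nonneg_left h2 (by positivity))
  rw [Finset.mul_sum]
  refine Finset.sum_le_sum fun p _ => ?_
  rw [← Finset.sum_filter, ← Finset.sum_mul]
  have h3 := sum_filter_pow_half_le (3 * K / ((p.1 : ℝ) + p.2 + 3)) (by positivity) M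
  refine (mul_le_mul_of_nonneg_right h3 (h.tourExcess_nonneg _ _)).trans (le_of_eq ?_)
  field_simp
  norm_num
  ring

/-- The multiscale estimate for the excesses of the triples of a regular tour. -/
theorem sum_minExcess_le (h : IsRegularTour C D) (M : ℕ) :
    ∑ m ∈ Finset.range M, (1 / 8 : ℝ) ^ m *
      ∑ s, ∑ j ∈ Finset.univ.filter (fun j => D s j ≤ 2 ^ m),
        ∑ k ∈ Finset.univ.filter (fun k => D s k ≤ 2 ^ m), minExcess D s j k ≤
    2 ^ 37 * C ^ 8 * N := by
  have hC1 : (1 : ℝ) ≤ C := by exact_mod_cast h.one_le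
  have h1 : ∀ m ∈ Finset.range M, (1 / 8 : ℝ) ^ m *
      ∑ s, ∑ j ∈ Finset.univ.filter (fun j => D s j ≤ 2 ^ m),
        ∑ k ∈ Finset.univ.filter (fun k => D s k ≤ 2 ^ m), minExcess D s j k ≤
      32 * C ^ 2 * ∑ j, arcGap C D m j / 2 ^ m +
      6912 * C ^ 2 * ((1 / 8 : ℝ) ^ m * ∑ x ∈ Finset.range ((8 * C + 1) * 2 ^ m),
        ∑ y ∈ Finset.range ((8 * C + 1) * 2 ^ m), tourExcess D (x + 1) (y + 1)) := by
    intro m _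
    refine (mul_le_mul_of_nonneg_left (h.sum_minExcess_scale_le m) (by positivity)).trans
      (le_of_eq ?_)
    have h2 : (1 / 8 : ℝ) ^ m * 4 ^ m = 1 / 2 ^ m := by
      rw [← mul_pow, ← one_div_pow]
      norm_num
    rw [← Finset.sum_div, mul_add]
    congr 1
    · calc _ = 32 * (C : ℝ) ^ 2 * (((1 / 8 : ℝ) ^ m * 4 ^ m) * ∑ j, arcGap C D m j) := by ring
        _ = _ := by rw [h2]; ring
    · ring
  refine (Finset.sum_le_sum h1).trans ?_
  rw [Finset.sum_add_distrib, ← Finset.mul_sum, ← Finset.mul_sum]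
  have h2 := h.sum_sum_arcGap_div_le M
  have h3 := h.sum_pow_mul_tourExcess_le (8 * C + 1) M
  have h4 : (((8 * C + 1 : ℕ) : ℝ)) ≤ 9 * C := by push_cast; linarith
  have hN : (0 : ℝ) ≤ N := by positivity
  have h5 : (C : ℝ) ^ 5 ≤ C ^ 8 := pow_le_pow_right₀ hC1 (by norm_num)
  calc _ ≤ 32 * (C : ℝ) ^ 2 * (2 ^ 31 * C ^ 6 * N) +
        6912 * (C : ℝ) ^ 2 * (54 * (9 * (C : ℝ)) ^ 3 * N) := by
        refine add_le_add (by gcongr) (mul_le_mul_of_nonneg_left (h3.trans ?_) (by positivity))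
        gcongr
    _ = 2 ^ 36 * ((C : ℝ) ^ 8 * N) + 6912 * 54 * 729 * ((C : ℝ) ^ 5 * N) := by ring
    _ ≤ 2 ^ 36 * ((C : ℝ) ^ 8 * N) + 6912 * 54 * 729 * ((C : ℝ) ^ 8 * N) := by gcongr
    _ ≤ 2 ^ 37 * ((C : ℝ) ^ 8 * N) := by
      have : 0 ≤ (C : ℝ) ^ 8 * N := by positivity
      linarith
    _ = _ := by ring

/-- The constant `c` absorbs the discretisation error. It is harmless because there are at most `N *
(C * 2 ^ m) ^ 2` triples at scale `m`, so its weighted sum is geometric. -/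
theorem sum_minExcess_add_le (h : IsRegularTour C D) (M : ℕ) (c : ℝ) (hc : 0 ≤ c) :
    ∑ m ∈ Finset.range M, (1 / 8 : ℝ) ^ m *
      ∑ s, ∑ j ∈ Finset.univ.filter (fun j => D s j ≤ 2 ^ m),
        ∑ k ∈ Finset.univ.filter (fun k => D s k ≤ 2 ^ m), (minExcess D s j k + c) ≤
    (2 ^ 37 * C ^ 8 + 2 * c * C ^ 2) * N := by
  simp_rw [Finset.sum_add_distrib, mul_add, Finset.sum_add_distrib]
  rw [add_mul]
  refine add_le_add (h.sum_minExcess_le M) ?_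
  have h1 : ∀ m ∈ Finset.range M, (1 / 8 : ℝ) ^ m *
      ∑ s, ∑ _j ∈ Finset.univ.filter (fun j => D s j ≤ 2 ^ m),
        ∑ _k ∈ Finset.univ.filter (fun k => D s k ≤ 2 ^ m), c ≤
      c * C ^ 2 * N * (1 / 2 : ℝ) ^ m := by
    intro m _
    have h2 : ∀ s ∈ (Finset.univ : Finset (ZMod N)),
        ∑ _j ∈ Finset.univ.filter (fun j => D s j ≤ 2 ^ m),
        ∑ _k ∈ Finset.univ.filter (fun k => D s k ≤ 2 ^ m), c ≤ (C * 2 ^ m) * ((C * 2 ^ m) * c) := by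
      intro s _
      simp only [Finset.sum_const, nsmul_eq_mul]
      have h3 := h.card_ball s (2 ^ m) (one_le_pow₀ (by norm_num))
      gcongr
    refine (mul_le_mul_of_nonneg_left (Finset.sum_le_sum h2) (by positivity)).trans (le_of_eq ?_)
    have h4 : (1 / 8 : ℝ) ^ m * (2 ^ m * 2 ^ m) = (1 / 2) ^ m := by
      rw [← mul_pow, ← mul_pow]
      norm_num
    rw [Finset.sum_const, Finset.card_univ, ZMod.card, nsmul_eq_mul]
    calc _ = c * (C : ℝ) ^ 2 * N * ((1 / 8 : ℝ) ^ m * (2 ^ m * 2 ^ m)) := by ring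
      _ = _ := by rw [h4]
  refine (Finset.sum_le_sum h1).trans ?_
  rw [← Finset.mul_sum]
  have h2 : ∑ m ∈ Finset.range M, (1 / 2 : ℝ) ^ m ≤ 2 := by
    have := geom_sum_Ico_le_of_lt_one (m := 0) (n := M) (x := (1 / 2 : ℝ)) (by norm_num)
      (by norm_num)
    rw [← Finset.range_eq_Ico] at this
    norm_num at this ⊢
    exact this
  refine (mul_le_mul_of_nonneg_left h2 (by positivity)).trans (le_of_eq ?_)
  ring

end IsRegularTour

/-! ### Closed walks through a finite net. -/

-- The walk goes around a spanning tree grown one vertex at a time: a new vertex `v` next to `u` is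
-- visited by the detour `u, v, u`. Both added visits are charged to `v`, and a ball containing `u`
-- contains `v` once enlarged by `h`; hence the visits to a ball are at most twice the vertices of
-- the enlarged ball.
open Classical in
theorem exists_list_tour {M : Type*} [PseudoMetricSpace M] (V : Finset M) {h : ℝ} (hh : 0 ≤ h)
    {root : M} (hroot : root ∈ V)
    (hV : ∀ S ⊆ V, S.Nonempty → S ≠ V → ∃ u ∈ S, ∃ v ∈ V, v ∉ S ∧ dist u v ≤ h) (k : ℕ)
    (hk : k + 1 ≤ V.card) :
    ∃ S ⊆ V, S.card = k + 1 ∧ ∃ l : List M, (∀ x, x ∈ l ↔ x ∈ S) ∧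
      l.IsChain (fun x y => dist x y ≤ h) ∧ l.head? = some root ∧ l.getLast? = some root ∧
      l.length ≤ 2 * S.card ∧ ∀ x R, (l.map fun y => if dist x y ≤ R then 1 else 0).sum ≤
        2 * (S.filter fun y => dist x y ≤ R + h).card := by
  induction k with
  | zero =>
    refine ⟨{root}, by simpa using hroot, by simp, [root], by simp, by simp, by simp, by simp,
      by simp, fun x R => ?_⟩
    by_cases hx : dist x root ≤ R
    · have : dist x root ≤ R + h := by linarith
      simp [hx, Finset.filter_singleton, this]
    · simp [hx]
  | succ k ih =>
    obtain ⟨S, hSV, hSk, l, hl, hchain, hhead, hlast, hlen, hcount⟩ := ih (by omega)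
    obtain ⟨u, huS, v, hvV, hvS, huv⟩ := hV S hSV (Finset.card_pos.1 (by omega))
      (fun he => by rw [he] at hSk; omega)
    obtain ⟨l₁, l₂, rfl⟩ := List.append_of_mem ((hl u).2 huS)
    rw [List.isChain_split] at hchain
    refine ⟨insert v S, Finset.insert_subset hvV hSV, by rw [Finset.card_insert_of_notMem hvS, hSk],
      l₁ ++ u :: v :: u :: l₂, fun x => ?_, ?_, ?_, ?_, ?_, fun x R => ?_⟩
    · rw [Finset.mem_insert, ← hl]
      simp only [List.mem_append, List.mem_cons]
      tauto
    · rw [List.isChain_split]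
      refine ⟨hchain.1, ?_⟩
      rw [List.isChain_cons_cons, List.isChain_cons_cons]
      exact ⟨huv, by rwa [dist_comm], hchain.2⟩
    · cases l₁ <;> simpa using hhead
    · cases l₂ <;> simpa using hlast
    · rw [Finset.card_insert_of_notMem hvS]
      simp only [List.length_append, List.length_cons] at hlen ⊢
      omega
    · have h1 := hcount x R
      rw [Finset.filter_insert]
      simp only [List.map_append, List.map_cons, List.sum_append, List.sum_cons] at h1 ⊢
      have h2 := dist_triangle x u v
      have h3 := dist_triangle x v u
      rw [dist_comm v u] at h3
      by_cases hv : dist x v ≤ R + h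
      · rw [if_pos hv, Finset.card_insert_of_notMem (by simp [hvS])]
        split_ifs at h1 ⊢ <;> omega
      · have hv1 : ¬ dist x v ≤ R := fun h' => hv (by linarith)
        have hu1 : ¬ dist x u ≤ R := fun h' => hv (by linarith)
        rw [if_neg hv]
        simp only [if_neg hv1, if_neg hu1] at h1 ⊢
        omega

theorem exists_isRegularTour {M : Type*} [PseudoMetricSpace M] (V : Finset M) {h : ℝ} (hh : 0 < h)
    (hne : V.Nonempty)
    (hV : ∀ S ⊆ V, S.Nonempty → S ≠ V → ∃ u ∈ S, ∃ v ∈ V, v ∉ S ∧ dist u v ≤ h) (C : ℕ)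
    (hC : ∀ x ∈ V, ∀ R : ℝ, 1 ≤ R →
      2 * ((V.filter fun y => dist x y ≤ h * R + h).card : ℝ) ≤ C * R) :
    ∃ (N : ℕ) (_ : NeZero N) (p : ZMod N → M), (∀ v ∈ V, ∃ i, p i = v) ∧ N ≤ 2 * V.card ∧
      IsRegularTour C fun i j => dist (p i) (p j) / h := by
  classical
  obtain ⟨root, hroot⟩ := hne
  have hpos : 0 < V.card := Finset.card_pos.2 ⟨root, hroot⟩
  obtain ⟨S, hSV, hSk, l, hl, hchain, hhead, hlast, hlen, hcount⟩ :=
    exists_list_tour V hh.le hroot hV (V.card - 1) (by omega)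
  obtain rfl : S = V := Finset.eq_of_subset_of_card_le hSV (by omega)
  obtain ⟨n, hn⟩ : ∃ n, l.length = n + 1 := by
    cases l with
    | nil => simp at hhead
    | cons a l => exact ⟨l.length, rfl⟩
  have hval : ∀ i : ZMod (n + 1), i.val < l.length := fun i => by
    rw [hn]
    exact ZMod.val_lt i
  refine ⟨n + 1, ⟨by omega⟩, fun i => l[i.val]'(hval i), fun v hv => ?_, by omega, ?_⟩
  · obtain ⟨k, hk, rfl⟩ := List.getElem_of_mem ((hl v).2 hv)
    refine ⟨(k : ZMod (n + 1)), ?_⟩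
    simp only [ZMod.val_natCast, Nat.mod_eq_of_lt (hn ▸ hk)]
  · refine ⟨fun i => by simp, fun i j => by rw [dist_comm], fun i j k => ?_, fun i => ?_,
      fun i R hR => ?_⟩
    · rw [← add_div]
      gcongr
      exact dist_triangle _ _ _
    · rw [div_le_one hh]
      by_cases hi : i.val + 1 < n + 1
      · have h1 : (i + 1).val = i.val + 1 := by
          rw [ZMod.val_add, ZMod.val_one_eq_one_mod, Nat.add_mod_mod, Nat.mod_eq_of_lt hi]
        simp only [h1]
        exact List.isChain_iff_getElem.1 hchain i.val (by omega)
      -- The step that closes the cycle has length zero, since the walk starts and ends at the root.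
      · have h2 : i.val = n := by have := ZMod.val_lt i; omega
        have h3 : (i + 1).val = 0 := by
          rw [ZMod.val_add, h2, ZMod.val_one_eq_one_mod]
          simp
        have h4 : l[0]'(by omega) = root := by
          rw [List.head?_eq_getElem?, List.getElem?_eq_getElem (by omega)] at hhead
          exact Option.some.inj hhead
        have h5 : l[n]'(by omega) = root := by
          rw [List.getLast?_eq_getElem?, hn, Nat.add_sub_cancel,
            List.getElem?_eq_getElem (by omega)] at hlast
          exact Option.some.inj hlast
        simp only [h2, h3, h4, h5, dist_self]
        exact hh.le
    · have h1 := hcount (l[i.val]'(hval i)) (h * R)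
      have h2 : (Finset.univ.filter fun j : ZMod (n + 1) =>
          dist (l[i.val]'(hval i)) (l[j.val]'(hval j)) / h ≤ R).card =
          (l.map fun y => if dist (l[i.val]'(hval i)) y ≤ h * R then 1 else 0).sum := by
        rw [← Fin.sum_univ_fun_getElem, Finset.card_filter]
        simp_rw [div_le_iff₀ hh, mul_comm R h]
        exact Fintype.sum_equiv (show ZMod (n + 1) ≃ Fin l.length from finCongr hn.symm) _ _
          fun _ => rfl
      rw [h2]
      refine le_trans ?_ (hC _ ((hl _).1 (List.getElem_mem (hval i))) R hR)
      exact_mod_cast h1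

/-! ### Nets in regular connected sets. -/

theorem dist_le_of_ediam_eq {M : Type*} [MetricSpace M] {Γ : Set M} {δ : ℝ} (hδ : 0 < δ)
    (hd : Metric.ediam Γ = ENNReal.ofReal δ) {x y : M} (hx : x ∈ Γ) (hy : y ∈ Γ) : dist x y ≤ δ := by
  have := Metric.edist_le_ediam_of_mem hx hy
  rw [hd, edist_dist] at this
  exact (ENNReal.ofReal_le_ofReal_iff hδ.le).1 this

/-- The `ε`-balls around `S` and around `V \ S` form two closed sets covering `Γ`, both of which
meet it. By connectedness they share a point, which joins the two parts by a step of at most `2 *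
ε`. -/
theorem IsMetricNet.exists_dist_le {M : Type*} [MetricSpace M] {Γ : Set M} {V : Finset M} {ε : ℝ}
    (hV : IsMetricNet ε (V : Set M) Γ) (hΓ : IsPreconnected Γ) (S : Finset M) (hSV : S ⊆ V) (hS : S.Nonempty) (hne : S ≠ V) :
    ∃ u ∈ S, ∃ v ∈ V, v ∉ S ∧ dist u v ≤ 2 * ε := by
  classical
  have hclosed : ∀ T : Finset M, IsClosed (⋃ x ∈ T, Metric.closedBall x ε) := fun T =>
    T.finite_toSet.isClosed_biUnion fun x _ => Metric.isClosed_closedBall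
  obtain ⟨u, hu⟩ := hS
  obtain ⟨v, hvV, hvS⟩ : ∃ v ∈ V, v ∉ S := by
    by_contra! hc
    exact hne (Finset.Subset.antisymm hSV hc)
  have hε : 0 ≤ ε := by
    obtain ⟨x, -, hx⟩ := hV.covers u (hV.subset (hSV hu))
    exact dist_nonneg.trans hx
  obtain ⟨z, -, hz1, hz2⟩ := isPreconnected_closed_iff.1 hΓ _ _ (hclosed S) (hclosed (V \ S))
    (fun y hy => by
      obtain ⟨x, hx, hxy⟩ := hV.covers y hy
      rw [dist_comm] at hxy
      by_cases hxS : x ∈ S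
      · exact Or.inl (Set.mem_iUnion₂.2 ⟨x, hxS, hxy⟩)
      · exact Or.inr (Set.mem_iUnion₂.2 ⟨x, Finset.mem_sdiff.2 ⟨hx, hxS⟩, hxy⟩))
    ⟨u, hV.subset (hSV hu), Set.mem_iUnion₂.2 ⟨u, hu, Metric.mem_closedBall_self hε⟩⟩
    ⟨v, hV.subset hvV, Set.mem_iUnion₂.2
      ⟨v, Finset.mem_sdiff.2 ⟨hvV, hvS⟩, Metric.mem_closedBall_self hε⟩⟩
  obtain ⟨a, ha, haz⟩ := Set.mem_iUnion₂.1 hz1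
  obtain ⟨b, hb, hbz⟩ := Set.mem_iUnion₂.1 hz2
  refine ⟨a, ha, b, (Finset.mem_sdiff.1 hb).1, (Finset.mem_sdiff.1 hb).2, ?_⟩
  have := dist_triangle_left a b z
  rw [Metric.mem_closedBall] at haz hbz
  linarith

section RegularSet

variable {M : Type*} [MetricSpace M] [MeasurableSpace M] [BorelSpace M] {Γ : Set M} {C₀ δ : ℝ}

namespace IsOneAhlforsRegular

theorem measure_ge (h : IsOneAhlforsRegular C₀ Γ) (hd : Metric.ediam Γ = ENNReal.ofReal δ) {x : M}
    (hx : x ∈ Γ) {r : ℝ} (hr : 0 < r) (hrδ : r ≤ δ) :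
    ENNReal.ofReal (r / C₀) ≤
      (Measure.hausdorffMeasure 1).restrict Γ (Metric.closedBall x r) :=
  (h.2 x hx r hr (hd ▸ ENNReal.ofReal_le_ofReal hrδ)).1

theorem measure_le (h : IsOneAhlforsRegular C₀ Γ) (hδ : 0 < δ)
    (hd : Metric.ediam Γ = ENNReal.ofReal δ) {x : M} (hx : x ∈ Γ) {r : ℝ} (hr : 0 < r) :
    (Measure.hausdorffMeasure 1).restrict Γ (Metric.closedBall x r) ≤ ENNReal.ofReal (C₀ * r) := by
  rcases le_total r δ with hrδ | hrδ
  · exact (h.2 x hx r hr (hd ▸ ENNReal.ofReal_le_ofReal hrδ)).2.le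
  · have h1 := (h.2 x hx δ hδ hd.ge).2.le
    have h2 : (Measure.hausdorffMeasure 1).restrict Γ (Metric.closedBall x r) ≤
        (Measure.hausdorffMeasure 1).restrict Γ (Metric.closedBall x δ) := by
      rw [Measure.restrict_apply Metric.isClosed_closedBall.measurableSet,
        Measure.restrict_apply Metric.isClosed_closedBall.measurableSet]
      refine measure_mono fun y hy => ⟨?_, hy.2⟩
      exact Metric.mem_closedBall.2 (dist_le_of_ediam_eq hδ hd hy.2 hx)
    refine (h2.trans h1).trans (ENNReal.ofReal_le_ofReal ?_)
    exact mul_le_mul_of_nonneg_left hrδ h.1.le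

theorem one_le (h : IsOneAhlforsRegular C₀ Γ) (hδ : 0 < δ)
    (hd : Metric.ediam Γ = ENNReal.ofReal δ) (hne : Γ.Nonempty) : 1 ≤ C₀ := by
  obtain ⟨x, hx⟩ := hne
  have h1 := (h.measure_ge hd hx hδ le_rfl).trans (h.measure_le hδ hd hx hδ)
  rw [ENNReal.ofReal_le_ofReal_iff (mul_pos h.1 hδ).le, div_le_iff₀ h.1] at h1
  by_contra! hc
  have := h.1
  have h2 : C₀ * C₀ < 1 := by nlinarith
  nlinarith

/-- The disjoint balls of radius `ε / 2` around the points of an `ε`-separated set bound its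
cardinality by the measure. -/
theorem card_mul_le_measure (h : IsOneAhlforsRegular C₀ Γ) (hd : Metric.ediam Γ = ENNReal.ofReal δ)
    {ε : ℝ} (hε : 0 < ε) (hεδ : ε ≤ 2 * δ) (S : Finset M) (hS : ↑S ⊆ Γ)
    (hsep : ∀ x ∈ S, ∀ y ∈ S, x ≠ y → ε < dist x y) (T : Set M)
    (hT : ∀ x ∈ S, Metric.closedBall x (ε / 2) ⊆ T) :
    ENNReal.ofReal (S.card * (ε / 2 / C₀)) ≤ (Measure.hausdorffMeasure 1).restrict Γ T := by
  have h1 : (Measure.hausdorffMeasure 1).restrict Γ (⋃ x ∈ S, Metric.closedBall x (ε / 2)) =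
      ∑ x ∈ S, (Measure.hausdorffMeasure 1).restrict Γ (Metric.closedBall x (ε / 2)) := by
    refine measure_biUnion_finset (fun x hx y hy hxy => ?_) fun x _ =>
      Metric.isClosed_closedBall.measurableSet
    refine Metric.closedBall_disjoint_closedBall ?_
    linarith [hsep x hx y hy hxy]
  refine le_trans ?_ (measure_mono (Set.iUnion₂_subset hT))
  rw [h1, ENNReal.ofReal_mul (by positivity), ENNReal.ofReal_natCast, ← nsmul_eq_mul]
  exact Finset.card_nsmul_le_sum _ _ _ fun x hx =>
    h.measure_ge hd (hS hx) (by linarith) (by linarith)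

theorem card_separated_le (h : IsOneAhlforsRegular C₀ Γ) (hδ : 0 < δ)
    (hd : Metric.ediam Γ = ENNReal.ofReal δ) {ε R : ℝ} (hε : 0 < ε) (hR : 0 < R) {x : M}
    (hx : x ∈ Γ) (S : Finset M) (hS : ↑S ⊆ Γ) (hSR : ∀ y ∈ S, dist x y ≤ R)
    (hsep : ∀ x ∈ S, ∀ y ∈ S, x ≠ y → ε < dist x y) :
    (S.card : ℝ) ≤ C₀ ^ 2 * (2 * R / ε + 1) := by
  have hC := h.one_le hδ hd ⟨x, hx⟩
  rcases le_or_gt ε (2 * δ) with hεδ | hεδ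
  · have h1 := h.card_mul_le_measure hd hε hεδ S hS hsep (Metric.closedBall x (R + ε / 2))
      fun y hy => Metric.closedBall_subset_closedBall' (by
        have := hSR y hy
        rw [dist_comm] at this
        linarith)
    have h2 := h1.trans (h.measure_le hδ hd hx (by positivity))
    rw [ENNReal.ofReal_le_ofReal_iff (by positivity)] at h2
    have h3 : (S.card : ℝ) * (ε / 2 / C₀) * (2 * C₀ / ε) ≤
        C₀ * (R + ε / 2) * (2 * C₀ / ε) := by gcongr
    have e1 : (S.card : ℝ) * (ε / 2 / C₀) * (2 * C₀ / ε) = S.card := by field_simp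
    have e2 : C₀ * (R + ε / 2) * (2 * C₀ / ε) = C₀ ^ 2 * (2 * R / ε + 1) := by field_simp
    rwa [e1, e2] at h3
  · have h1 : S.card ≤ 1 := Finset.card_le_one.2 fun a ha b hb => by
      by_contra hab
      have h1 := hsep a ha b hb hab
      have h2 := dist_le_of_ediam_eq hδ hd (hS ha) (hS hb)
      linarith
    have h2 : (S.card : ℝ) ≤ 1 := by exact_mod_cast h1
    have h3 : (1 : ℝ) ≤ C₀ ^ 2 := one_le_pow₀ hC
    have h4 : 0 ≤ 2 * R / ε := by positivity
    nlinarith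

/-- Separated subsets have bounded cardinality, so one of maximal cardinality exists, and maximality
makes it a net. -/
theorem exists_finset_net (h : IsOneAhlforsRegular C₀ Γ) (hδ : 0 < δ)
    (hd : Metric.ediam Γ = ENNReal.ofReal δ) (hne : Γ.Nonempty) {ε : ℝ} (hε : 0 < ε) :
    ∃ V : Finset M, IsMetricNet ε (V : Set M) Γ := by
  classical
  obtain ⟨x, hx⟩ := hne
  set P : Finset M → Prop := fun S => ↑S ⊆ Γ ∧ ∀ x ∈ S, ∀ y ∈ S, x ≠ y → ε < dist x y with hP
  set T : Set ℕ := {n | ∃ S, P S ∧ S.card = n} with hT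
  have hbdd : BddAbove T := by
    refine ⟨⌈C₀ ^ 2 * (2 * δ / ε + 1)⌉₊, ?_⟩
    rintro n ⟨S, hS, rfl⟩
    have := h.card_separated_le hδ hd hε hδ hx S hS.1
      (fun y hy => dist_le_of_ediam_eq hδ hd hx (hS.1 hy)) hS.2
    exact_mod_cast this.trans (Nat.le_ceil _)
  obtain ⟨V, hV, hVc⟩ := Nat.sSup_mem (s := T) ⟨0, ∅, by simp [hP], rfl⟩ hbdd
  refine ⟨V, hV.1, hV.2, fun y hy => ?_⟩
  by_contra! hc
  have hyV : y ∉ V := fun hyV => by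
    have := hc y hyV
    rw [dist_self] at this
    linarith
  have h1 : P (insert y V) := by
    refine ⟨?_, fun a ha b hb hab => ?_⟩
    · rw [Finset.coe_insert]
      exact Set.insert_subset hy hV.1
    · rcases Finset.mem_insert.1 ha with rfl | ha'
      · rcases Finset.mem_insert.1 hb with rfl | hb'
        · exact absurd rfl hab
        · rw [dist_comm]
          exact hc b hb'
      · rcases Finset.mem_insert.1 hb with rfl | hb'
        · exact hc a ha'
        · exact hV.2 a ha' b hb' hab
  have h2 := le_csSup hbdd ⟨_, h1, rfl⟩
  rw [Finset.card_insert_of_notMem hyV] at h2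
  omega

end IsOneAhlforsRegular

/-! ### Discretisation of the integrals. -/

/-- The integral over a ball is at most the sum of the upper bounds over the cells of a net. -/
theorem setLIntegral_closedBall_le_sum (h : IsOneAhlforsRegular C₀ Γ) (hδ : 0 < δ)
    (hd : Metric.ediam Γ = ENNReal.ofReal δ) {V : Finset M} {ε : ℝ} (hε : 0 < ε)
    (hV : IsMetricNet ε (V : Set M) Γ) (c : M) (r : ℝ) (f : M → ENNReal) (b : M → ENNReal)
    (hfb : ∀ v ∈ V, ∀ x, dist x v ≤ ε → f x ≤ b v) :
    ∫⁻ x in Metric.closedBall c r, f x ∂((Measure.hausdorffMeasure 1).restrict Γ) ≤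
      ∑ v ∈ V.filter (fun v => dist c v ≤ r + ε), b v * ENNReal.ofReal (C₀ * ε) := by
  set V' := V.filter (fun v => dist c v ≤ r + ε) with hV'
  set μ := (Measure.hausdorffMeasure 1 : Measure M).restrict Γ with hμ
  -- `Γ` is not known to be measurable, so the inclusion is proved almost everywhere: the uncovered
  -- part of the ball is Borel and disjoint from `Γ`.
  have hae : Metric.closedBall c r ≤ᵐ[μ] ⋃ v : V', Metric.closedBall (v : M) ε := by
    have hm : MeasurableSet (Metric.closedBall c r \ ⋃ v : V', Metric.closedBall (v : M) ε) :=
      Metric.isClosed_closedBall.measurableSet.diff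
        (MeasurableSet.iUnion fun v => Metric.isClosed_closedBall.measurableSet)
    rw [ae_le_set, hμ, Measure.restrict_apply hm]
    convert measure_empty (μ := Measure.hausdorffMeasure 1)
    rw [Set.eq_empty_iff_forall_notMem]
    rintro x ⟨⟨hx1, hx2⟩, hx3⟩
    obtain ⟨v, hv, hvx⟩ := hV.covers x hx3
    refine hx2 (Set.mem_iUnion.2 ⟨⟨v, Finset.mem_filter.2 ⟨hv, ?_⟩⟩, ?_⟩)
    · have := dist_triangle c x v
      rw [Metric.mem_closedBall] at hx1
      rw [dist_comm] at hx1 hvx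
      linarith
    · rw [Metric.mem_closedBall, dist_comm]
      exact hvx
  refine (lintegral_mono' (Measure.restrict_mono_ae hae) le_rfl).trans ?_
  refine (lintegral_iUnion_le _ _).trans ?_
  rw [tsum_fintype, ← Finset.sum_coe_sort V']
  refine Finset.sum_le_sum fun v _ => ?_
  have hvV := (Finset.mem_filter.1 v.2).1
  calc ∫⁻ x in Metric.closedBall (v : M) ε, f x ∂μ
      ≤ ∫⁻ _x in Metric.closedBall (v : M) ε, b v ∂μ :=
        setLIntegral_mono' Metric.isClosed_closedBall.measurableSet fun x hx => hfb v hvV x hx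
    _ = b v * μ (Metric.closedBall (v : M) ε) := setLIntegral_const _ _
    _ ≤ b v * ENNReal.ofReal (C₀ * ε) := by
      gcongr
      exact h.measure_le hδ hd (hV.subset hvV) hε

end RegularSet

theorem tripleExcess_nonneg {M : Type*} [MetricSpace M] (x y z : M) : 0 ≤ tripleExcess x y z := by
  have h1 := dist_triangle x y z
  have h2 := dist_triangle y z x
  have h3 := dist_triangle z x y
  unfold tripleExcess orderedExcess
  refine le_min ?_ (le_min ?_ ?_) <;> linarith

theorem orderedExcess_le_add {M : Type*} [MetricSpace M] {ε : ℝ} {x y z u v w : M}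
    (hx : dist x u ≤ ε) (hy : dist y v ≤ ε) (hz : dist z w ≤ ε) :
    orderedExcess x y z ≤ orderedExcess u v w + 6 * ε := by
  have h1 := dist_triangle4 x u v y
  have h2 := dist_triangle4 y v w z
  have h3 := dist_triangle4 u x z w
  rw [dist_comm v y] at h1
  rw [dist_comm w z] at h2
  rw [dist_comm u x] at h3
  unfold orderedExcess
  linarith

theorem tripleExcess_le_add {M : Type*} [MetricSpace M] {ε : ℝ} {x y z u v w : M}
    (hx : dist x u ≤ ε) (hy : dist y v ≤ ε) (hz : dist z w ≤ ε) :
    tripleExcess x y z ≤ tripleExcess u v w + 6 * ε := by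
  unfold tripleExcess
  rw [← min_add_add_right, ← min_add_add_right]
  exact min_le_min (orderedExcess_le_add hx hy hz)
    (min_le_min (orderedExcess_le_add hy hz hx) (orderedExcess_le_add hz hx hy))

theorem tripleExcess_eq_mul_minExcess {M ι : Type*} [MetricSpace M] (p : ι → M) {h : ℝ}
    (hh : 0 < h) (i j k : ι) :
    tripleExcess (p i) (p j) (p k) = h * minExcess (fun i j => dist (p i) (p j) / h) i j k := by
  have h1 : ∀ i j k, h * excess (fun i j => dist (p i) (p j) / h) i j k =
      orderedExcess (p i) (p j) (p k) := fun i j k => by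
    unfold excess orderedExcess
    field_simp
  unfold minExcess tripleExcess
  rw [mul_min_of_nonneg _ _ hh.le, mul_min_of_nonneg _ _ hh.le, h1, h1, h1]

/-- Sums over a finite set of triples are dominated by sums over a tour through this set. -/
theorem sum_tripleExcess_le_tour {M : Type*} [MetricSpace M] {N : ℕ} [NeZero N] {C : ℕ}
    (V : Finset M) (p : ZMod N → M) (hp : ∀ v ∈ V, ∃ i, p i = v) {ε R : ℝ} (hε : 0 < ε) (l : ℕ)
    (hR : R ≤ 2 * ε * 2 ^ l)
    (hD : IsRegularTour C fun i j => dist (p i) (p j) / (2 * ε)) :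
    ∑ u ∈ V, ∑ v ∈ V.filter (fun v => dist u v ≤ R), ∑ w ∈ V.filter (fun w => dist u w ≤ R),
      (tripleExcess u v w + 6 * ε) ≤
    2 * ε * ∑ s, ∑ j ∈ Finset.univ.filter (fun j => dist (p s) (p j) / (2 * ε) ≤ 2 ^ l),
      ∑ k ∈ Finset.univ.filter (fun k => dist (p s) (p k) / (2 * ε) ≤ 2 ^ l),
        (minExcess (fun i j => dist (p i) (p j) / (2 * ε)) s j k + 3) := by
  have hε2 : 0 < 2 * ε := by linarith
  choose! q hq using hp
  have hinj : Set.InjOn q V := fun u hu v hv huv => by rw [← hq u hu, ← hq v hv, huv]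
  have hinj' : ∀ u, Set.InjOn q (V.filter fun v => dist u v ≤ R) := fun u =>
    hinj.mono fun v hv => (Finset.mem_filter.1 hv).1
  have hmaps : ∀ u ∈ V, ∀ v ∈ V.filter (fun v => dist u v ≤ R), q v ∈ Finset.univ.filter
      fun j => dist (p (q u)) (p j) / (2 * ε) ≤ 2 ^ l := fun u hu v hv => by
    rw [Finset.mem_filter] at hv ⊢
    rw [hq u hu, hq v hv.1, div_le_iff₀ hε2]
    exact ⟨Finset.mem_univ _, by linarith [hv.2]⟩
  have hpos : ∀ i j k, 0 ≤ minExcess (fun i j => dist (p i) (p j) / (2 * ε)) i j k + 3 :=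
    fun i j k => by linarith [hD.minExcess_nonneg i j k]
  rw [Finset.mul_sum]
  refine le_trans (Finset.sum_le_sum fun u hu => ?_) (sum_comp_le_of_injOn q
    (fun s => mul_nonneg hε2.le (Finset.sum_nonneg fun j _ => Finset.sum_nonneg fun k _ =>
      hpos s j k)) (fun _ _ => Finset.mem_univ _) hinj)
  rw [Finset.mul_sum]
  refine le_trans (Finset.sum_le_sum fun v hv => ?_) (sum_comp_le_of_injOn q
    (fun j => mul_nonneg hε2.le (Finset.sum_nonneg fun k _ => hpos _ j k)) (hmaps u hu) (hinj' u))
  rw [Finset.mul_sum]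
  refine le_trans (Finset.sum_le_sum fun w hw => ?_) (sum_comp_le_of_injOn q
    (fun k => mul_nonneg hε2.le (hpos _ _ k)) (hmaps u hu) (hinj' u))
  have := tripleExcess_eq_mul_minExcess p hε2 (q u) (q v) (q w)
  rw [hq u hu, hq v (Finset.mem_filter.1 hv).1, hq w (Finset.mem_filter.1 hw).1] at this
  rw [this]
  apply le_of_eq
  ring

section RegularSet

variable {M : Type*} [MetricSpace M] [MeasurableSpace M] [BorelSpace M] {Γ : Set M} {C₀ δ : ℝ}

theorem setLIntegral_closedBall_le_ofReal (h : IsOneAhlforsRegular C₀ Γ) (hδ : 0 < δ)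
    (hd : Metric.ediam Γ = ENNReal.ofReal δ) {V : Finset M} {ε : ℝ} (hε : 0 < ε)
    (hV : IsMetricNet ε (V : Set M) Γ) (c : M) (r : ℝ) (f : M → ENNReal) (b : M → ℝ)
    (hb : ∀ v, 0 ≤ b v) (hfb : ∀ v ∈ V, ∀ x, dist x v ≤ ε → f x ≤ ENNReal.ofReal (b v)) :
    ∫⁻ x in Metric.closedBall c r, f x ∂((Measure.hausdorffMeasure 1).restrict Γ) ≤
      ENNReal.ofReal (C₀ * ε * ∑ v ∈ V.filter (fun v => dist c v ≤ r + ε), b v) := by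
  refine (setLIntegral_closedBall_le_sum h hδ hd hε hV c r f _ hfb).trans (le_of_eq ?_)
  rw [← Finset.sum_mul, ← ENNReal.ofReal_sum_of_nonneg fun v _ => hb v, mul_comm,
    ← ENNReal.ofReal_mul (mul_nonneg h.1.le hε.le)]

theorem ballExcess_le_ofReal (h : IsOneAhlforsRegular C₀ Γ) (hδ : 0 < δ)
    (hd : Metric.ediam Γ = ENNReal.ofReal δ) {V : Finset M} {ε : ℝ} (hε : 0 < ε)
    (hV : IsMetricNet ε (V : Set M) Γ) (c : M) {r : ℝ} (hr : 0 < r) :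
    ballExcess Γ c r ≤ ENNReal.ofReal ((C₀ * ε) ^ 3 * r ^ (-3 : ℤ) *
      ∑ u ∈ V.filter (fun v => dist c v ≤ r + ε), ∑ v ∈ V.filter (fun v => dist c v ≤ r + ε),
        ∑ w ∈ V.filter (fun v => dist c v ≤ r + ε), (tripleExcess u v w + 6 * ε)) := by
  set V' := V.filter (fun v => dist c v ≤ r + ε) with hV'
  have hq : 0 ≤ C₀ * ε := mul_nonneg h.1.le hε.le
  have hr3 : 0 ≤ r ^ (-3 : ℤ) := by positivity
  have hg : ∀ u v w : M, 0 ≤ (tripleExcess u v w + 6 * ε) * r ^ (-3 : ℤ) := fun u v w =>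
    mul_nonneg (add_nonneg (tripleExcess_nonneg u v w) (by positivity)) hr3
  have key := setLIntegral_closedBall_le_ofReal h hδ hd hε hV c r
    (fun x => ∫⁻ y in Metric.closedBall c r, ∫⁻ z in Metric.closedBall c r,
      ENNReal.ofReal (tripleExcess x y z * r ^ (-3 : ℤ)) ∂((Measure.hausdorffMeasure 1).restrict Γ)
      ∂((Measure.hausdorffMeasure 1).restrict Γ))
    (fun u => C₀ * ε * ∑ v ∈ V', C₀ * ε * ∑ w ∈ V', (tripleExcess u v w + 6 * ε) * r ^ (-3 : ℤ))
    (fun u => mul_nonneg hq (Finset.sum_nonneg fun v _ => mul_nonneg hq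
      (Finset.sum_nonneg fun w _ => hg u v w)))
    (fun u _ x hx => setLIntegral_closedBall_le_ofReal h hδ hd hε hV c r _ _
      (fun v => mul_nonneg hq (Finset.sum_nonneg fun w _ => hg u v w))
      (fun v _ y hy => setLIntegral_closedBall_le_ofReal h hδ hd hε hV c r _ _ (hg u v)
        (fun w _ z hz => ENNReal.ofReal_le_ofReal
          (mul_le_mul_of_nonneg_right (tripleExcess_le_add hx hy hz) hr3))))
  refine key.trans (le_of_eq ?_)
  congr 1
  simp_rw [← Finset.sum_mul, ← Finset.mul_sum, ← Finset.sum_mul]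
  ring

/-- Bounded overlap: the centres within `2 * A * ρ` of a given point of `V` are `ρ`-separated, so
there are at most `C₀ ^ 2 * (4 * A + 1)` of them. Thus the triples of all balls of one generation
are controlled by triples based at the points of `V`. -/
theorem tsum_ballExcess_le_ofReal (h : IsOneAhlforsRegular C₀ Γ) (hδ : 0 < δ)
    (hd : Metric.ediam Γ = ENNReal.ofReal δ) {V : Finset M} {ε : ℝ} (hε : 0 < ε)
    (hV : IsMetricNet ε (V : Set M) Γ) {A ρ : ℝ} (hA : 1 < A) (hρ : ε ≤ ρ) {X K : Set M}
    (hK : K ⊆ Γ) (hX : IsMetricNet ρ X K) :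
    ∑' x : X, ballExcess Γ (x : M) (A * ρ) ≤
      ENNReal.ofReal ((C₀ * ε) ^ 3 * (A * ρ) ^ (-3 : ℤ) * (C₀ ^ 2 * (4 * A + 1) *
        ∑ u ∈ V, ∑ v ∈ V.filter (fun v => dist u v ≤ 4 * (A * ρ)),
          ∑ w ∈ V.filter (fun w => dist u w ≤ 4 * (A * ρ)), (tripleExcess u v w + 6 * ε))) := by
  classical
  have hρ0 : 0 < ρ := hε.trans_le hρ
  have hr : 0 < A * ρ := by nlinarith
  have hεr : ε ≤ A * ρ := by nlinarith
  set r := A * ρ with hr'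
  have hκ : 0 ≤ (C₀ * ε) ^ 3 * r ^ (-3 : ℤ) := by
    have := h.1
    positivity
  have hg : ∀ u v w : M, 0 ≤ tripleExcess u v w + 6 * ε := fun u v w =>
    add_nonneg (tripleExcess_nonneg u v w) (by positivity)
  set T : M → ℝ := fun u => ∑ v ∈ V.filter (fun v => dist u v ≤ 4 * r),
    ∑ w ∈ V.filter (fun w => dist u w ≤ 4 * r), (tripleExcess u v w + 6 * ε) with hT
  have hT0 : ∀ u, 0 ≤ T u := fun u => Finset.sum_nonneg fun v _ => Finset.sum_nonneg fun w _ =>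
    hg u v w
  rw [ENNReal.tsum_eq_iSup_sum]
  refine iSup_le fun S => ?_
  have h1 : ∀ c : M, ∑ u ∈ V.filter (fun v => dist c v ≤ r + ε),
      ∑ v ∈ V.filter (fun v => dist c v ≤ r + ε), ∑ w ∈ V.filter (fun v => dist c v ≤ r + ε),
        (tripleExcess u v w + 6 * ε) ≤ ∑ u ∈ V.filter (fun v => dist c v ≤ 2 * r), T u := by
    intro c
    have hsub : ∀ u ∈ V.filter (fun v => dist c v ≤ r + ε), V.filter (fun v => dist c v ≤ r + ε) ⊆
        V.filter (fun v => dist u v ≤ 4 * r) := fun u hu v hv => by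
      rw [Finset.mem_filter] at hu hv ⊢
      refine ⟨hv.1, ?_⟩
      linarith [dist_triangle_left u v c]
    refine (Finset.sum_le_sum fun u hu => ?_).trans (Finset.sum_le_sum_of_subset_of_nonneg
      (f := T) (fun u hu => ?_) fun u _ _ => hT0 u)
    · refine (Finset.sum_le_sum fun v _ => Finset.sum_le_sum_of_subset_of_nonneg (hsub u hu)
        fun w _ _ => hg u v w).trans ?_
      exact Finset.sum_le_sum_of_subset_of_nonneg (hsub u hu) fun v _ _ =>
        Finset.sum_nonneg fun w _ => hg u v w
    · rw [Finset.mem_filter] at hu ⊢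
      exact ⟨hu.1, by linarith [hu.2]⟩
  refine (Finset.sum_le_sum fun (c : X) _ => (ballExcess_le_ofReal h hδ hd hε hV (c : M) hr).trans
    (ENNReal.ofReal_le_ofReal (mul_le_mul_of_nonneg_left (h1 (c : M)) hκ))).trans ?_
  rw [← ENNReal.ofReal_sum_of_nonneg fun c _ => mul_nonneg hκ (Finset.sum_nonneg fun u _ => hT0 u),
    ← Finset.mul_sum]
  refine ENNReal.ofReal_le_ofReal (mul_le_mul_of_nonneg_left ?_ hκ)
  simp_rw [Finset.sum_filter]
  rw [Finset.sum_comm, Finset.mul_sum]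
  refine Finset.sum_le_sum fun u hu => ?_
  rw [← Finset.sum_filter, Finset.sum_const, nsmul_eq_mul]
  refine mul_le_mul_of_nonneg_right ?_ (hT0 u)
  have h2 := h.card_separated_le hδ hd hρ0 (R := 2 * r) (by positivity) (hV.subset hu)
    ((S.filter fun c : X => dist (c : M) u ≤ 2 * r).map (Function.Embedding.subtype (· ∈ X)))
    (fun x hx => by
      obtain ⟨c, -, rfl⟩ := Finset.mem_map.1 hx
      exact hK (hX.subset c.2))
    (fun x hx => by
      obtain ⟨c, hc, rfl⟩ := Finset.mem_map.1 hx
      rw [dist_comm]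
      exact (Finset.mem_filter.1 hc).2)
    (fun x hx y hy hxy => by
      obtain ⟨c, -, rfl⟩ := Finset.mem_map.1 hx
      obtain ⟨c', -, rfl⟩ := Finset.mem_map.1 hy
      exact hX.separated _ c.2 _ c'.2 hxy)
  rw [Finset.card_map] at h2
  refine h2.trans (le_of_eq ?_)
  rw [hr']
  field_simp
  ring

/-! ### From the tour estimate to the theorem. -/

theorem exists_net_regularTour (h : IsOneAhlforsRegular C₀ Γ) (hΓ : IsConnected Γ) (hδ : 0 < δ)
    (hd : Metric.ediam Γ = ENNReal.ofReal δ) {ε : ℝ} (hε : 0 < ε) (hεδ : ε ≤ δ) :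
    ∃ V : Finset M, IsMetricNet ε (V : Set M) Γ ∧ ∃ (N : ℕ) (_ : NeZero N) (p : ZMod N → M),
      (∀ v ∈ V, ∃ i, p i = v) ∧
      IsRegularTour ⌈18 * C₀ ^ 2⌉₊ (fun i j => dist (p i) (p j) / (2 * ε)) ∧
      ENNReal.ofReal (N * ε) ≤ ENNReal.ofReal (4 * C₀) * Measure.hausdorffMeasure 1 Γ := by
  obtain ⟨V, hV⟩ := h.exists_finset_net hδ hd hΓ.nonempty hε
  have hne : V.Nonempty := by
    obtain ⟨x, hx⟩ := hΓ.nonempty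
    obtain ⟨v, hv, -⟩ := hV.covers x hx
    exact ⟨v, hv⟩
  have hC0 := h.1
  obtain ⟨N, hN, p, hp, hNV, hD⟩ := exists_isRegularTour V (h := 2 * ε) (by linarith) hne
    (hV.exists_dist_le hΓ.isPreconnected) ⌈18 * C₀ ^ 2⌉₊ (fun x hx R hR => by
      have h1 := h.card_separated_le hδ hd hε (R := 2 * ε * R + 2 * ε) (by positivity)
        (hV.subset hx) (V.filter fun y => dist x y ≤ 2 * ε * R + 2 * ε)
        (fun y hy => hV.subset (Finset.mem_filter.1 hy).1) (fun y hy => (Finset.mem_filter.1 hy).2)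
        (fun y hy z hz => hV.separated y (Finset.mem_filter.1 hy).1 z (Finset.mem_filter.1 hz).1)
      have h2 : 2 * (2 * ε * R + 2 * ε) / ε + 1 = 4 * R + 5 := by
        field_simp
        ring
      rw [h2] at h1
      have h3 : (18 * C₀ ^ 2 : ℝ) ≤ ⌈18 * C₀ ^ 2⌉₊ := Nat.le_ceil _
      have h4 : C₀ ^ 2 * (4 * R + 5) ≤ C₀ ^ 2 * (9 * R) := by gcongr; linarith
      nlinarith)
  refine ⟨V, hV, N, hN, p, hp, hD, ?_⟩
  have h1 := h.card_mul_le_measure hd hε (by linarith) V hV.subset hV.separated Set.univ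
    fun _ _ => Set.subset_univ _
  rw [Measure.restrict_apply_univ] at h1
  refine le_trans ?_ (mul_le_mul_right h1 _)
  rw [← ENNReal.ofReal_mul (by positivity)]
  refine ENNReal.ofReal_le_ofReal ?_
  have h2 : 4 * C₀ * (V.card * (ε / 2 / C₀)) = 2 * V.card * ε := by field_simp; norm_num
  rw [h2]
  gcongr
  exact_mod_cast hNV

theorem sum_tsum_ballExcess_le (h : IsOneAhlforsRegular C₀ Γ) (hΓ : IsConnected Γ) (hδ : 0 < δ)
    (hd : Metric.ediam Γ = ENNReal.ofReal δ) {A : ℝ} (hA : 1 < A) (l : ℕ) (hl : 2 * A ≤ 2 ^ l)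
    {K : Set M} (hK : K ⊆ Γ) {X : ℤ → Set M}
    (hX : ∀ n : ℤ, IsMetricNet ((2 : ℝ) ^ (-n)) (X n) K) (F : Finset ℤ) :
    ∑ n ∈ F, ∑' x : X n, ballExcess Γ (x : M) (A * (2 : ℝ) ^ (-n)) ≤
      ENNReal.ofReal ((C₀ / A) ^ 3 * (C₀ ^ 2 * (4 * A + 1)) * 2 * 8 ^ l *
        (2 ^ 37 * (⌈18 * C₀ ^ 2⌉₊ : ℝ) ^ 8 + 6 * (⌈18 * C₀ ^ 2⌉₊ : ℝ) ^ 2) * (4 * C₀)) *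
      Measure.hausdorffMeasure 1 Γ := by
  have hC0 := h.1
  set C := ⌈18 * C₀ ^ 2⌉₊ with hC
  -- The mesh depends on the finite set `F` of generations, but the resulting bound does not, so a
  -- supremum over `F` is possible afterwards.
  obtain ⟨n₀, hn₀F, hn₀δ⟩ : ∃ n₀ : ℤ, (∀ n ∈ F, n ≤ n₀) ∧ (2 : ℝ) ^ (-n₀) ≤ δ := by
    obtain ⟨k, hk⟩ := exists_pow_lt_of_lt_one hδ (by norm_num : (1 / 2 : ℝ) < 1)
    obtain ⟨n₁, hn₁⟩ := F.bddAbove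
    refine ⟨max n₁ k, fun n hn => (hn₁ hn).trans (le_max_left _ _), ?_⟩
    refine le_trans (zpow_le_zpow_right₀ (by norm_num) (neg_le_neg (le_max_right n₁ (k : ℤ)))) ?_
    rw [zpow_neg, zpow_natCast, ← inv_pow, ← one_div]
    exact hk.le
  set ε : ℝ := (2 : ℝ) ^ (-n₀) with hε'
  have hε : 0 < ε := by positivity
  obtain ⟨V, hV, N, hN, p, hp, hD, hNε⟩ := exists_net_regularTour h hΓ hδ hd hε hn₀δ
  set S : ℕ → ℝ := fun m => ∑ s,
    ∑ j ∈ Finset.univ.filter (fun j => dist (p s) (p j) / (2 * ε) ≤ 2 ^ m),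
      ∑ k ∈ Finset.univ.filter (fun k => dist (p s) (p k) / (2 * ε) ≤ 2 ^ m),
        (minExcess (fun i j => dist (p i) (p j) / (2 * ε)) s j k + 3) with hS
  have hS0 : ∀ m, 0 ≤ S m := fun m => Finset.sum_nonneg fun s _ => Finset.sum_nonneg fun j _ =>
    Finset.sum_nonneg fun k _ => by linarith [hD.minExcess_nonneg s j k]
  set B : ℝ := (C₀ / A) ^ 3 * (C₀ ^ 2 * (4 * A + 1)) * 2 * 8 ^ l with hB
  have hB0 : 0 ≤ B := by positivity
  have hscale : ∀ n ∈ F, ∑' x : X n, ballExcess Γ (x : M) (A * (2 : ℝ) ^ (-n)) ≤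
      ENNReal.ofReal (B * ε * ((1 / 8 : ℝ) ^ ((n₀ - n).toNat + l) * S ((n₀ - n).toNat + l))) := by
    intro n hn
    set m := (n₀ - n).toNat with hm
    have hρ : (2 : ℝ) ^ (-n) = 2 ^ m * ε := by
      have h1 : (m : ℤ) = n₀ - n := Int.toNat_of_nonneg (by linarith [hn₀F n hn])
      rw [hε', ← zpow_natCast, h1, ← zpow_add₀ (by norm_num)]
      congr 1
      ring
    have h2m : (1 : ℝ) ≤ 2 ^ m := one_le_pow₀ (by norm_num)
    have h1 := tsum_ballExcess_le_ofReal h hδ hd hε hV hA (ρ := 2 ^ m * ε) (by nlinarith) hK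
      (hρ ▸ hX n)
    rw [hρ]
    refine h1.trans (ENNReal.ofReal_le_ofReal ?_)
    -- The condition `2 * A ≤ 2 ^ l` says that balls of radius `4 * A * 2 ^ m * ε` fit into tour
    -- balls of radius `2 ^ (m + l)` in units of `2 * ε`. Shifting the scale by `l` costs the factor
    -- `8 ^ l`.
    have h2 := sum_tripleExcess_le_tour V p hp hε (R := 4 * (A * (2 ^ m * ε))) (m + l) (by
      rw [pow_add]
      have : 2 * A * (2 * (2 ^ m * ε)) ≤ 2 ^ l * (2 * (2 ^ m * ε)) := by gcongr
      linarith) hD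
    refine (mul_le_mul_of_nonneg_left (mul_le_mul_of_nonneg_left h2 (by positivity))
      (by positivity)).trans (le_of_eq ?_)
    change _ * (_ * (2 * ε * S (m + l))) = _
    have h8 : (1 / 8 : ℝ) ^ (m + l) = 1 / ((2 ^ m) ^ 3 * 8 ^ l) := by
      rw [one_div_pow, pow_add, ← pow_mul, mul_comm m 3, pow_mul]
      norm_num
    rw [h8, hB, zpow_neg]
    rw [show ((3 : ℤ)) = ((3 : ℕ) : ℤ) from rfl, zpow_natCast]
    have hA0 : 0 < A := by linarith
    field_simp
  refine (Finset.sum_le_sum hscale).trans ?_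
  have hterm : ∀ m, 0 ≤ (1 / 8 : ℝ) ^ m * S m := fun m => mul_nonneg (by positivity) (hS0 m)
  rw [← ENNReal.ofReal_sum_of_nonneg fun n _ => mul_nonneg (by positivity) (hterm _),
    ← Finset.mul_sum]
  obtain ⟨L, hL⟩ : ∃ L : ℕ, ∀ n ∈ F, (n₀ - n).toNat + l < L := by
    obtain ⟨L, hL⟩ := (F.image fun n => (n₀ - n).toNat + l).bddAbove
    exact ⟨L + 1, fun n hn => Nat.lt_succ_of_le (hL (Finset.mem_image_of_mem _ hn))⟩
  have h1 := sum_comp_le_of_injOn (s := F) (t := Finset.range L)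
    (f := fun m => (1 / 8 : ℝ) ^ m * S m) (fun n => (n₀ - n).toNat + l) hterm
    (fun n hn => Finset.mem_range.2 (hL n hn)) (fun n hn n' hn' hnn => by
      have := hn₀F n hn
      have := hn₀F n' hn'
      simp only at hnn
      omega)
  have h2 := h1.trans (hD.sum_minExcess_add_le L 3 (by norm_num))
  refine (ENNReal.ofReal_le_ofReal (mul_le_mul_of_nonneg_left h2 (by positivity))).trans ?_
  have h3 := mul_le_mul_right hNε
    (ENNReal.ofReal (B * (2 ^ 37 * (C : ℝ) ^ 8 + 6 * (C : ℝ) ^ 2)))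
  rw [← mul_assoc, ← ENNReal.ofReal_mul (by positivity), ← ENNReal.ofReal_mul (by positivity)] at h3
  refine le_trans (le_of_eq ?_) h3
  congr 1
  ring

end RegularSet

theorem mainTheorem1 (C₀ A : ℝ) (hA : 1 < A) :
    ∃ C : ℝ, 0 < C ∧
      ∀ (M : Type*) [MetricSpace M] [MeasurableSpace M] [BorelSpace M] (Γ K : Set M)
        (X : ℤ → Set M),
        IsConnected Γ → IsOneAhlforsRegular C₀ Γ → K ⊆ Γ →
        (∀ n : ℤ, IsMetricNet ((2 : ℝ) ^ (-n)) (X n) K) →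
        ∑' (n : ℤ) (x : X n), ballExcess Γ (x : M) (A * (2 : ℝ) ^ (-n)) ≤
          ENNReal.ofReal C * Measure.hausdorffMeasure 1 Γ := by
  obtain ⟨l, hl⟩ := pow_unbounded_of_one_lt (2 * A) (by norm_num : (1 : ℝ) < 2)
  set B : ℝ := (C₀ / A) ^ 3 * (C₀ ^ 2 * (4 * A + 1)) * 2 * 8 ^ l *
    (2 ^ 37 * (⌈18 * C₀ ^ 2⌉₊ : ℝ) ^ 8 + 6 * (⌈18 * C₀ ^ 2⌉₊ : ℝ) ^ 2) * (4 * C₀)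
  -- The maximum with `1` keeps the constant positive for every real `C₀`, and makes the right-hand
  -- side infinite when `ℋ¹(Γ)` is.
  refine ⟨max B 1, by positivity, fun M _ _ _ Γ K X hΓ h hK hX => ?_⟩
  obtain ⟨x, hx⟩ := hΓ.nonempty
  rcases eq_or_ne (Measure.hausdorffMeasure 1 Γ) ⊤ with htop | htop
  · rw [htop, ENNReal.mul_top (by simp)]
    exact le_top
  rcases eq_or_ne (Metric.ediam Γ) 0 with h0 | h0
  · have hΓ0 : Measure.hausdorffMeasure 1 Γ = 0 :=
      haveI := Measure.nullSingletonClass_hausdorff M (d := 1) one_pos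
      (Metric.ediam_eq_zero_iff.1 h0).measure_zero _
    have hr : (Measure.hausdorffMeasure 1).restrict Γ = 0 := Measure.restrict_eq_zero.2 hΓ0
    simp [ballExcess, hr]
  -- For infinite diameter, lower regularity at radius `C₀ * (H + 1)` would give measure at least `H
  -- + 1`, where `H` is the finite total measure.
  have hdtop : Metric.ediam Γ ≠ ⊤ := by
    intro hinf
    have hC0 := h.1
    set H := (Measure.hausdorffMeasure 1 Γ).toReal with hH
    have hH0 : 0 ≤ H := ENNReal.toReal_nonneg
    have h1 := (h.2 x hx (C₀ * (H + 1)) (by positivity) (by rw [hinf]; exact le_top)).1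
    have h2 := h1.trans (measure_mono (Set.subset_univ _))
    rw [Measure.restrict_apply_univ, mul_div_cancel_left₀ _ hC0.ne',
      ENNReal.ofReal_le_iff_le_toReal htop] at h2
    linarith
  have hδ : 0 < (Metric.ediam Γ).toReal := ENNReal.toReal_pos h0 hdtop
  have hd : Metric.ediam Γ = ENNReal.ofReal (Metric.ediam Γ).toReal :=
    (ENNReal.ofReal_toReal hdtop).symm
  rw [ENNReal.tsum_eq_iSup_sum]
  refine iSup_le fun F => (sum_tsum_ballExcess_le h hΓ hδ hd hA l hl.le hK hX F).trans ?_
  gcongr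
  exact le_max_left _ _
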